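/- Let $n \ge 1$ and let $\Lambda \subset \mathbb{R}^n$ be a lattice of full rank, that is, a discrete subgroup of $\mathbb{R}^n$ that spans $\mathbb{R}^n$ over $\mathbb{R}$. Let $\nu(\Lambda) = \sup_{x \in \mathbb{R}^n} \min_{\lambda \in \Lambda} \|x - \lambda\|_2$ be its covering radius, and let $B, B_1$ be real numbers with \[ B \ge 8\, n^{n/2}\, \nu(\Lambda) \quad\text{and}\quad B_1 \ge 8\, n^2 (n+1)\, B. \] Let $x_1, \dots, x_n$ be random vectors, each uniformly distributed on the finite set $\Lambda \cap [0, B)^n$, and let $y_1, \dots, y_{n+1}$ be random vectors, each uniformly distributed on the finite set $\Lambda \cap [0, B_1)^n$, such that all $2n+1$ of these vectors are independent. Then the probability that $x_1, \dots, x_n, y_1, \dots, y_{n+1}$ generate $\Lambda$ as an abelian group is at least \[ \alpha_n := \biggl( \prod_{i=2}^{n+1} \zeta(i)^{-1} - \frac14 \biggr) \cdot \prod_{k=0}^{n-1} \biggl( 1 - n^{k/2}\, \frac{(4 n^{n/2} + 1)^k}{(4 n^{n/2} - 1)^n} \biggr), \] where $\zeta$ is the Riemann zeta function, and moreover $\alpha_n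 \ge 0.092$. -/

import Mathlib

open MeasureTheory ProbabilityTheory

noncomputable section

/-- The covering radius of a full-rank lattice `L` in Euclidean space: the
largest distance of a point of the space from `L`. For a full-rank lattice these distances are
bounded, so the supremum is not a junk value. -/
def coveringRadius {n : ℕ} (L : Submodule ℤ (EuclideanSpace ℝ (Fin n))) : ℝ :=
  ⨆ x : EuclideanSpace ℝ (Fin n), Metric.infDist x (L : Set (EuclideanSpace ℝ (Fin n)))

/-- The half-open cube `[0, B)ⁿ`. -/
def window (n : ℕ) (B : ℝ) : Set (EuclideanSpace ℝ (Fin n)) :=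
  {x | ∀ i, x i ∈ Set.Ico 0 B}

/-- The constant `αₙ`. The values `ζ(i)` for integers `i ≥ 2` are real, so that taking the real
part only changes the type. The powers with exponents `k / 2` and `n / 2` are real powers. -/
def alpha (n : ℕ) : ℝ :=
  ((∏ i ∈ Finset.Icc 2 (n + 1), ((riemannZeta (i : ℂ)).re)⁻¹) - 1 / 4) *
    ∏ k ∈ Finset.range n,
      (1 - (n : ℝ) ^ ((k : ℝ) / 2) *
        ((4 * (n : ℝ) ^ ((n : ℝ) / 2) + 1) ^ k / (4 * (n : ℝ) ^ ((n : ℝ) / 2) - 1) ^ n))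

end

/-!
# The probability that short random vectors generate a lattice

Only lower bounds are needed, and all of them come from counting. By independence and uniformity
(`card_div_prod_le_measureReal`), it suffices to count the pairs of tuples `x`, `y` of lattice
points of the two windows such that `x` is linearly independent over `ℝ` and `x`, `y` together
generate `L`. The two factors of `αₙ` correspond to the two conditions.

*Independence of `x`.* The lattice has a measurable tile `F` within the ball of radius `ν`, the
covering radius (`exists_isTile_subset_closedBall`). Comparing volumes of unions of translates of
`F` with those of boxes, the window `[0, B)ⁿ` has at least `(B - 2ν)ⁿ / vol F` lattice points, while
a subspace spanned by `k` vectors contains at most `(√n (B + 2ν))ᵏ (2ν)ⁿ⁻ᵏ / vol F` of them: in an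
orthonormal basis adapted to the subspace, the tiles in question lie in a box with these sides. So
each new vector falls into the span of the previous `k` ones with probability at most
`subspaceBound n k`, the `k`-th term of the product in `αₙ` (`card_linearIndependent_ge`).

*Generation.* Given independent `x`, let `M` be the sublattice that it generates. The parallelepiped
of `x` is a tile of `M` inside `[0, nB]ⁿ`, so the points of `[0, B₁)ⁿ` are distributed over the
cosets of `M` uniformly up to a factor `((B₁ - nB) / (B₁ + nB))ⁿ` (`exists_card_coset_bounds`), and
the `n + 1` classes of `y` in `L / M` are jointly uniform up to the factor `3 / 4`. In a finite
abelian group with `n` generators, the proportion of generating `(n + 1)`-tuples is at least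
`p = ∏ ζ(i)⁻¹`, over `2 ≤ i ≤ n + 1` (`invZetaProd_mul_card_pow_le`): the group is a quotient of
`(ℤ/m)ⁿ`, where by Cauchy's theorem a tuple generates as soon as it does modulo every prime
divisor of `m`, and these conditions are independent by the Chinese remainder theorem; modulo
a prime `q` the proportion is `∏ (1 - q⁻ⁱ)`, and the Euler product applies. Finally
`3p / 4 ≥ p - 1 / 4`, as `p ≤ 1`.

*The value of `αₙ`.* As `∑ (ζ(i) - 1) = 1` over `i ≥ 2`, the zeta product is at least `1 - 6 / π²`,
and the other product is at least `0.65`.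
-/

/-! ### The zeta product -/

theorem re_riemannZeta_nat {i : ℕ} (hi : 2 ≤ i) :
    (riemannZeta (i : ℂ)).re = ∑' k : ℕ, 1 / (k : ℝ) ^ i := by
  rw [zeta_nat_eq_tsum_of_gt_one (by omega), ← Complex.ofReal_re (∑' k : ℕ, 1 / (k : ℝ) ^ i),
    Complex.ofReal_tsum]
  push_cast
  rfl

theorem re_riemannZeta_nat_eq_one_add {i : ℕ} (hi : 2 ≤ i) :
    (riemannZeta (i : ℂ)).re = 1 + ∑' k : ℕ, 1 / ((k : ℝ) + 2) ^ i := by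
  rw [re_riemannZeta_nat hi,
    ← (Real.summable_one_div_nat_pow.mpr (by omega : 1 < i)).sum_add_tsum_nat_add 2]
  have h0 : i ≠ 0 := by omega
  simp [Finset.sum_range_succ, h0]

theorem one_le_re_riemannZeta_nat {i : ℕ} (hi : 2 ≤ i) : 1 ≤ (riemannZeta (i : ℂ)).re := by
  rw [re_riemannZeta_nat_eq_one_add hi, le_add_iff_nonneg_right]
  exact tsum_nonneg fun k => by positivity

/-- A finite part of the Euler product of `ζ(i)⁻¹` bounds it from above, as each of the remaining
factors is at most `1`. -/
theorem inv_re_riemannZeta_le_prod_primes {i : ℕ} (hi : 2 ≤ i) (s : Finset ℕ)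
    (hs : ∀ p ∈ s, p.Prime) :
    ((riemannZeta (i : ℂ)).re)⁻¹ ≤ ∏ p ∈ s, (1 - 1 / (p : ℝ) ^ i) := by
  let f : ℕ →* ℝ :=
    { toFun := fun k => 1 / (k : ℝ) ^ i
      map_one' := by simp
      map_mul' := fun a b => by push_cast; rw [mul_pow, one_div_mul_one_div] }
  have hsum : Summable fun k : ℕ => f k := Real.summable_one_div_nat_pow.mpr (by omega)
  have hlt : ∀ {p : ℕ}, p.Prime → 1 / (p : ℝ) ^ i < 1 := fun {p} hp => by
    have : (1 : ℝ) < p := by exact_mod_cast hp.one_lt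
    rw [div_lt_one (by positivity)]
    exact one_lt_pow₀ this (by omega)
  obtain ⟨-, h⟩ := EulerProduct.summable_and_hasSum_factoredNumbers_prod_filter_prime_geometric
    (f := f) (fun {p} hp => by
      rw [Real.norm_of_nonneg (by simp only [f, MonoidHom.coe_mk, OneHom.coe_mk]; positivity)]
      exact hlt hp) s
  have hle : ∏ p ∈ s, (1 - 1 / (p : ℝ) ^ i)⁻¹ ≤ (riemannZeta (i : ℂ)).re := by
    rw [re_riemannZeta_nat hi]
    rw [Finset.filter_true_of_mem hs] at h
    refine (h.tsum_eq.symm.trans_le ?_)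
    exact hsum.tsum_subtype_le _ (Nat.factoredNumbers s) fun k => by
      simp only [f, MonoidHom.coe_mk, OneHom.coe_mk]; positivity
  have hpos : 0 < ∏ p ∈ s, (1 - 1 / (p : ℝ) ^ i) :=
    Finset.prod_pos fun p hp => sub_pos.mpr (hlt (hs p hp))
  rw [Finset.prod_inv_distrib] at hle
  exact inv_le_of_inv_le₀ hpos hle

/-- For every `N`, `∑ (ζ(i) - 1) ≤ 1` over `2 ≤ i ≤ N`: summing over `i` first leaves the
telescoping series of `1 / ((k + 1) (k + 2))`. -/
theorem sum_re_riemannZeta_sub_one_le (N : ℕ) :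
    ∑ i ∈ Finset.Icc 2 N, ((riemannZeta (i : ℂ)).re - 1) ≤ 1 := by
  have h1 : ∑ i ∈ Finset.Icc 2 N, ((riemannZeta (i : ℂ)).re - 1) =
      ∑ i ∈ Finset.Icc 2 N, ∑' k : ℕ, 1 / ((k : ℝ) + 2) ^ i :=
    Finset.sum_congr rfl fun i hi => by
      rw [re_riemannZeta_nat_eq_one_add (Finset.mem_Icc.mp hi).1]; ring
  have hs : ∀ i ∈ Finset.Icc 2 N, Summable fun k : ℕ => 1 / ((k : ℝ) + 2) ^ i := fun i hi => by
    have := (summable_nat_add_iff 2).mpr (Real.summable_one_div_nat_pow.mpr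
      (show 1 < i by have := (Finset.mem_Icc.mp hi).1; omega))
    simpa using this
  rw [h1, ← Summable.tsum_finsetSum hs]
  have hgeom : ∀ k : ℕ, ∑ i ∈ Finset.Icc 2 N, 1 / ((k : ℝ) + 2) ^ i ≤
      1 / ((k : ℝ) + 1) - 1 / ((k : ℝ) + 2) := fun k => by
    have key : ∀ M : ℕ, ∑ i ∈ Finset.Icc 2 (M + 1), 1 / ((k : ℝ) + 2) ^ i =
        (1 / ((k : ℝ) + 1) - 1 / ((k : ℝ) + 2)) - 1 / (((k : ℝ) + 1) * ((k : ℝ) + 2) ^ (M + 1)) := by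
      intro M
      induction M with
      | zero => simp; field_simp; ring
      | succ M ih =>
        rw [Finset.sum_Icc_succ_top (by omega), ih]
        field_simp
        ring
    rcases N with _ | M
    · have : (0 : ℝ) ≤ 1 / ((k : ℝ) + 1) - 1 / ((k : ℝ) + 2) :=
        sub_nonneg.mpr (one_div_le_one_div_of_le (by positivity) (by linarith))
      simpa using this
    · rw [key M]
      have : (0 : ℝ) ≤ 1 / (((k : ℝ) + 1) * ((k : ℝ) + 2) ^ (M + 1)) := by positivity
      linarith
  refine Real.tsum_le_of_sum_range_le (fun k => Finset.sum_nonneg fun i _ => by positivity)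
    fun K => (Finset.sum_le_sum fun k _ => hgeom k).trans ?_
  have htel : ∀ K : ℕ, ∑ k ∈ Finset.range K, (1 / ((k : ℝ) + 1) - 1 / ((k : ℝ) + 2)) =
      1 - 1 / ((K : ℝ) + 1) := by
    intro K
    induction K with
    | zero => simp
    | succ K ih => rw [Finset.sum_range_succ, ih]; push_cast; ring
  rw [htel]
  have : (0 : ℝ) ≤ 1 / ((K : ℝ) + 1) := by positivity
  linarith

/-- The product `∏ ζ(i)⁻¹` over `2 ≤ i ≤ n + 1`. -/
noncomputable def invZetaProd (n : ℕ) : ℝ :=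
  ∏ i ∈ Finset.Icc 2 (n + 1), ((riemannZeta (i : ℂ)).re)⁻¹

theorem invZetaProd_le_one (n : ℕ) : invZetaProd n ≤ 1 :=
  Finset.prod_le_one
    (fun _ hi => inv_nonneg.mpr
      (zero_le_one.trans (one_le_re_riemannZeta_nat (Finset.mem_Icc.mp hi).1)))
    fun _ hi => inv_le_one_of_one_le₀ (one_le_re_riemannZeta_nat (Finset.mem_Icc.mp hi).1)

theorem invZetaProd_nonneg (n : ℕ) : 0 ≤ invZetaProd n :=
  Finset.prod_nonneg
    (fun _ hi => inv_nonneg.mpr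
      (zero_le_one.trans (one_le_re_riemannZeta_nat (Finset.mem_Icc.mp hi).1)))

theorem one_sub_sum_le_prod_one_sub {ι : Type*} (s : Finset ι) (f : ι → ℝ)
    (h0 : ∀ i ∈ s, 0 ≤ f i) (h1 : ∀ i ∈ s, f i ≤ 1) :
    1 - ∑ i ∈ s, f i ≤ ∏ i ∈ s, (1 - f i) := by
  classical
  induction s using Finset.induction_on with
  | empty => simp
  | insert a s ha ih =>
    rw [Finset.sum_insert ha, Finset.prod_insert ha]
    have ih' := ih (fun i hi => h0 i (Finset.mem_insert_of_mem hi))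
      (fun i hi => h1 i (Finset.mem_insert_of_mem hi))
    have ha0 := h0 a (Finset.mem_insert_self _ _)
    have ha1 := h1 a (Finset.mem_insert_self _ _)
    have hs : 0 ≤ ∑ i ∈ s, f i := Finset.sum_nonneg fun i hi => h0 i (Finset.mem_insert_of_mem hi)
    nlinarith [mul_le_mul_of_nonneg_left ih' (sub_nonneg.mpr ha1), mul_nonneg ha0 hs]

/-- With `ζ(2) = π² / 6` split off, the remaining factors contribute at least
`1 - ∑ (ζ(i) - 1) ≥ 1 - (2 - π² / 6)`. -/
theorem one_sub_six_div_pi_sq_le_invZetaProd {n : ℕ} (hn : 1 ≤ n) :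
    1 - 6 / Real.pi ^ 2 ≤ invZetaProd n := by
  have h2 : (riemannZeta ((2 : ℕ) : ℂ)).re = Real.pi ^ 2 / 6 := by
    have : (riemannZeta ((2 : ℕ) : ℂ)) = ((Real.pi ^ 2 / 6 : ℝ) : ℂ) := by
      push_cast; exact riemannZeta_two
    rw [this, Complex.ofReal_re]
  have hpi : 3.14 < Real.pi := Real.pi_gt_d2
  have hpi2 : (9 : ℝ) < Real.pi ^ 2 := by nlinarith
  have hsplit : Finset.Icc 2 (n + 1) = insert 2 (Finset.Icc 3 (n + 1)) := by
    ext x; simp only [Finset.mem_Icc, Finset.mem_insert]; omega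
  have hsum := sum_re_riemannZeta_sub_one_le (n + 1)
  rw [hsplit, Finset.sum_insert (by simp), h2] at hsum
  have hz : ∀ i ∈ Finset.Icc 3 (n + 1), 1 ≤ (riemannZeta (i : ℂ)).re := fun i hi =>
    one_le_re_riemannZeta_nat (by have := (Finset.mem_Icc.mp hi).1; omega)
  have hprod : 1 - ∑ i ∈ Finset.Icc 3 (n + 1), ((riemannZeta (i : ℂ)).re - 1) ≤
      ∏ i ∈ Finset.Icc 3 (n + 1), ((riemannZeta (i : ℂ)).re)⁻¹ := by
    have hinv : ∀ z : ℝ, 1 ≤ z → 1 - z⁻¹ ≤ z - 1 := fun z hz => by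
      have hz0 : 0 < z := by linarith
      have : z + z⁻¹ - 2 = (z - 1) ^ 2 / z := by field_simp; ring
      have h3 : 0 ≤ (z - 1) ^ 2 / z := by positivity
      linarith
    have h := one_sub_sum_le_prod_one_sub (Finset.Icc 3 (n + 1))
      (fun i : ℕ => 1 - ((riemannZeta (i : ℂ)).re)⁻¹)
      (fun i hi => sub_nonneg.mpr (inv_le_one_of_one_le₀ (hz i hi)))
      (fun i hi => sub_le_self _ (inv_nonneg.mpr (zero_le_one.trans (hz i hi))))
    simp only [sub_sub_cancel] at h
    refine le_trans ?_ h
    exact sub_le_sub_left (Finset.sum_le_sum fun i hi => hinv _ (hz i hi)) _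
  rw [invZetaProd, hsplit, Finset.prod_insert (by simp), h2]
  have h3 : Real.pi ^ 2 / 6 - 1 ≤ ∏ i ∈ Finset.Icc 3 (n + 1), ((riemannZeta (i : ℂ)).re)⁻¹ := by
    linarith
  calc 1 - 6 / Real.pi ^ 2 = (Real.pi ^ 2 / 6)⁻¹ * (Real.pi ^ 2 / 6 - 1) := by field_simp
    _ ≤ _ := mul_le_mul_of_nonneg_left h3 (by positivity)

/-! ### Estimates for the proportion of lattice points in a subspace -/

/-- The bound for the proportion of lattice points of the window that lie in a given
`k`-dimensional subspace. -/
noncomputable def subspaceBound (n k : ℕ) : ℝ :=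
  (n : ℝ) ^ ((k : ℝ) / 2) *
    ((4 * (n : ℝ) ^ ((n : ℝ) / 2) + 1) ^ k / (4 * (n : ℝ) ^ ((n : ℝ) / 2) - 1) ^ n)

theorem rpow_natCast_div_two (n k : ℕ) : (n : ℝ) ^ ((k : ℝ) / 2) = √(n : ℝ) ^ k := by
  rw [Real.sqrt_eq_rpow, ← Real.rpow_mul_natCast (by positivity)]
  congr 1; ring

theorem one_le_sqrt_pow {n : ℕ} (hn : 1 ≤ n) (k : ℕ) : 1 ≤ √(n : ℝ) ^ k :=
  one_le_pow₀ (Real.one_le_sqrt.mpr (by exact_mod_cast hn))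

theorem subspaceBound_eq (n k : ℕ) : subspaceBound n k =
    √(n : ℝ) ^ k * ((4 * √(n : ℝ) ^ n + 1) ^ k / (4 * √(n : ℝ) ^ n - 1) ^ n) := by
  rw [subspaceBound, rpow_natCast_div_two, rpow_natCast_div_two]

theorem subspaceBound_nonneg {n : ℕ} (hn : 1 ≤ n) (k : ℕ) : 0 ≤ subspaceBound n k := by
  have := one_le_sqrt_pow hn n
  rw [subspaceBound_eq]
  have : 0 < 4 * √(n : ℝ) ^ n - 1 := by linarith
  positivity

theorem subspaceBound_succ (n k : ℕ) :
    subspaceBound n (k + 1) = subspaceBound n k * (√(n : ℝ) * (4 * √(n : ℝ) ^ n + 1)) := by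
  rw [subspaceBound_eq, subspaceBound_eq]
  ring

theorem subspaceBound_mono {n : ℕ} (hn : 1 ≤ n) : Monotone (subspaceBound n) := by
  refine monotone_nat_of_le_succ fun k => ?_
  rw [subspaceBound_succ]
  refine le_mul_of_one_le_right (subspaceBound_nonneg hn k) ?_
  have h1 := one_le_sqrt_pow hn n
  have h2 := one_le_sqrt_pow hn 1
  rw [pow_one] at h2
  nlinarith

/-- The dominant term is the one with `k = n - 1`, about `1 / (4 √n)`. -/
theorem subspaceBound_top_le {n : ℕ} (hn : 3 ≤ n) :
    √(n : ℝ) * subspaceBound n (n - 1) ≤ 3 / 8 := by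
  obtain ⟨m, rfl⟩ : ∃ m, n = m + 1 := ⟨n - 1, by omega⟩
  have hn' : (3 : ℝ) ≤ ((m + 1 : ℕ) : ℝ) := by exact_mod_cast hn
  rw [subspaceBound_eq, Nat.add_sub_cancel]
  set r : ℝ := ((m + 1 : ℕ) : ℝ) with hr
  set a := √r with ha
  have ha2 : a ^ 2 = r := Real.sq_sqrt (by linarith)
  have ha17 : 1.7 ≤ a := Real.le_sqrt_of_sq_le (by norm_num; linarith)
  set N := a ^ (m + 1) with hN
  have hNr : 1.7 * r ≤ N := by
    calc 1.7 * r ≤ a * a ^ 2 := by rw [ha2]; gcongr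
      _ = a ^ 3 := by ring
      _ ≤ a ^ (m + 1) := pow_le_pow_right₀ (by linarith) hn
  have hN1 : 0 < 4 * N - 1 := by linarith
  -- Bernoulli's inequality for `((4N - 1) / (4N + 1)) ^ n = (1 - 2 / (4N + 1)) ^ n`
  have hb : 2 / 3 ≤ ((4 * N - 1) / (4 * N + 1)) ^ (m + 1) := by
    have h := one_add_mul_le_pow (a := -(2 / (4 * N + 1))) (by
      have : 2 / (4 * N + 1) ≤ 2 := div_le_self (by norm_num) (by linarith)
      linarith) (m + 1)
    rw [← hr] at h
    have e : 1 + -(2 / (4 * N + 1)) = (4 * N - 1) / (4 * N + 1) := by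
      have : (4 * N + 1) ≠ 0 := by linarith
      field_simp; ring
    rw [e] at h
    refine le_trans ?_ h
    have : r * (2 / (4 * N + 1)) ≤ 1 / 3 := by
      rw [mul_div_assoc', div_le_iff₀ (by linarith)]
      linarith
    linarith
  rw [div_pow, le_div_iff₀ (by positivity)] at hb
  have e : a * (a ^ m * ((4 * N + 1) ^ m / (4 * N - 1) ^ (m + 1))) =
      (N * (4 * N + 1) ^ m) / (4 * N - 1) ^ (m + 1) := by
    rw [hN]; ring
  rw [e, div_le_iff₀ (by positivity)]
  have h2 : 4 * (N * (4 * N + 1) ^ m) ≤ (4 * N + 1) ^ (m + 1) := by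
    rw [pow_succ]
    have : 0 ≤ (4 * N + 1) ^ m := by positivity
    nlinarith
  linarith

theorem subspaceBound_top_le_one {n : ℕ} (hn : 1 ≤ n) : subspaceBound n (n - 1) ≤ 1 := by
  obtain rfl | rfl | h3 : n = 1 ∨ n = 2 ∨ 3 ≤ n := by omega
  · rw [subspaceBound_eq]; norm_num
  · rw [subspaceBound_eq]
    have h : √(2 : ℝ) ≤ 1.5 := Real.sqrt_le_iff.mpr (by norm_num)
    norm_num
    linarith
  · have h1 := subspaceBound_top_le h3
    have h2 := one_le_sqrt_pow hn 1
    have h3 := subspaceBound_nonneg hn (n - 1)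
    rw [pow_one] at h2
    nlinarith

theorem subspaceBound_le_one {n k : ℕ} (hk : k < n) : subspaceBound n k ≤ 1 :=
  (subspaceBound_mono (by omega) (by omega : k ≤ n - 1)).trans
    (subspaceBound_top_le_one (by omega))

/-- For `n ≥ 3` the sum of the `subspaceBound n k` is controlled by the dominant term; the products
for `n ≤ 2` are evaluated. -/
theorem prod_one_sub_subspaceBound_ge {n : ℕ} (hn : 1 ≤ n) :
    0.65 ≤ ∏ k ∈ Finset.range n, (1 - subspaceBound n k) := by
  obtain rfl | rfl | h3 : n = 1 ∨ n = 2 ∨ 3 ≤ n := by omega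
  · simp only [Finset.prod_range_one, subspaceBound_eq]; norm_num
  · have h : √(2 : ℝ) ≤ 1.5 := Real.sqrt_le_iff.mpr (by norm_num)
    simp only [Finset.prod_range_succ, Finset.prod_range_zero, subspaceBound_eq]
    norm_num
    linarith
  · refine le_trans ?_ (one_sub_sum_le_prod_one_sub (Finset.range n) _
      (fun k _ => subspaceBound_nonneg hn k)
      (fun k hk => subspaceBound_le_one (Finset.mem_range.mp hk)))
    obtain ⟨m, rfl⟩ : ∃ m, n = m + 2 := ⟨n - 2, by omega⟩
    have htop := subspaceBound_top_le h3
    have hstep := subspaceBound_succ (m + 2) m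
    rw [show m + 2 - 1 = m + 1 by omega] at htop
    have hn' : (3 : ℝ) ≤ ((m + 2 : ℕ) : ℝ) := by exact_mod_cast h3
    have hlow : ∑ k ∈ Finset.range (m + 1), subspaceBound (m + 2) k ≤
        ((m + 2 : ℕ) : ℝ) * subspaceBound (m + 2) m := by
      calc _ ≤ ∑ k ∈ Finset.range (m + 1), subspaceBound (m + 2) m :=
            Finset.sum_le_sum fun k hk =>
              subspaceBound_mono hn (Nat.lt_succ_iff.mp (Finset.mem_range.mp hk))
        _ = ((m + 1 : ℕ) : ℝ) * subspaceBound (m + 2) m := by simp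
        _ ≤ _ := by
          have := subspaceBound_nonneg hn m
          gcongr
          omega
    rw [Finset.sum_range_succ]
    set r : ℝ := ((m + 2 : ℕ) : ℝ) with hr
    set a := √r with ha
    have ha2 : a ^ 2 = r := Real.sq_sqrt (by linarith)
    have ha17 : 1.7 ≤ a := Real.le_sqrt_of_sq_le (by norm_num; linarith)
    have hN : a ^ 2 ≤ a ^ (m + 2) := pow_le_pow_right₀ (by linarith) (by omega)
    set q := subspaceBound (m + 2) m
    set q' := subspaceBound (m + 2) (m + 1)
    have hq : 0 ≤ q := subspaceBound_nonneg hn m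
    have hq' : 4 * 1.7 * (r * q) ≤ q' := by
      rw [hstep]
      have : 4 * 1.7 * r ≤ a * (4 * a ^ (m + 2) + 1) := by
        rw [← ha2]; nlinarith
      nlinarith
    have hq'' : 1.7 * q' ≤ 3 / 8 := by
      have : 0 ≤ q' := subspaceBound_nonneg hn _
      nlinarith
    norm_num at hq' hq'' ⊢
    linarith

theorem alpha_eq (n : ℕ) : alpha n =
    (invZetaProd n - 1 / 4) * ∏ k ∈ Finset.range n, (1 - subspaceBound n k) := rfl

theorem le_alpha {n : ℕ} (hn : 1 ≤ n) : 0.092 ≤ alpha n := by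
  have h1 := one_sub_six_div_pi_sq_le_invZetaProd hn
  have h2 := prod_one_sub_subspaceBound_ge hn
  have hpi : 3.1415 < Real.pi := Real.pi_gt_d4
  have h3 : 6 / Real.pi ^ 2 ≤ 0.608 := by
    rw [div_le_iff₀ (by positivity)]
    nlinarith
  rw [alpha_eq]
  calc (0.092 : ℝ) ≤ 0.142 * 0.65 := by norm_num
    _ ≤ _ := mul_le_mul (by norm_num at h3 ⊢; linarith) h2 (by norm_num)
      (by norm_num at h3 ⊢; linarith)

/-! ### Generating a finite abelian group -/

/-- Under a surjective homomorphism of finite groups, the proportion of a set equals that of its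
preimage. -/
theorem AddMonoidHom.ncard_preimage_mul_card {A C : Type*} [AddGroup A] [AddGroup C] [Finite A]
    (f : A →+ C) (hf : Function.Surjective f) (S : Set C) :
    (f ⁻¹' S).ncard * Nat.card C = S.ncard * Nat.card A := by
  classical
  have : Finite C := Finite.of_surjective f hf
  have := Fintype.ofFinite A
  have := Fintype.ofFinite C
  have hfib : ∀ c, (Finset.univ.filter fun a => f a = c).card =
      (Finset.univ.filter fun a => f a = 0).card := fun c =>
    AddMonoidHom.card_fiber_eq_of_mem_range f (hf c) (hf 0)
  have hcount : ∀ T : Finset C, (Finset.univ.filter fun a => f a ∈ T).card =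
      T.card * (Finset.univ.filter fun a => f a = 0).card := fun T => by
    rw [Finset.card_eq_sum_card_fiberwise (f := f) (t := T) (fun a ha => by simpa using ha),
      Finset.sum_const_nat (m := (Finset.univ.filter fun a => f a = 0).card)]
    intro c hc
    rw [← hfib c]
    congr 1
    ext a
    simp only [Finset.mem_filter, Finset.mem_univ, true_and]
    exact ⟨fun h => h.2, fun h => ⟨h ▸ hc, h⟩⟩
  have h1 := hcount S.toFinset
  have h2 := hcount Finset.univ
  simp only [Finset.mem_univ, Finset.filter_true, Finset.card_univ] at h2
  rw [Nat.card_eq_fintype_card, Nat.card_eq_fintype_card, h2, Set.ncard_eq_toFinset_card',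
    Set.ncard_eq_toFinset_card', Set.toFinset_card (f ⁻¹' S)]
  have h3 : Fintype.card (f ⁻¹' S) = (Finset.univ.filter fun a => f a ∈ S.toFinset).card := by
    rw [← Set.toFinset_card]; congr 1; ext a; simp
  rw [h3, h1]
  ring

/-- If the tuple `g` generates a finite abelian group modulo `p` for every prime `p` dividing its
order, then it generates the group: otherwise multiplication by a prime divisor `p` of the order of
the quotient by `g` would be surjective, hence injective, on that quotient, against Cauchy's
theorem. -/
theorem span_eq_top_of_forall_prime {G ι : Type*} [AddCommGroup G] [Finite G] (g : ι → G)
    (h : ∀ p : ℕ, p.Prime → p ∣ Nat.card G →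
      ∀ v : G, ∃ w : G, v - p • w ∈ Submodule.span ℤ (Set.range g)) :
    Submodule.span ℤ (Set.range g) = ⊤ := by
  set H := Submodule.span ℤ (Set.range g) with hH
  by_contra hne
  have hnt : Nontrivial (G ⧸ H) := Submodule.Quotient.nontrivial_iff.mpr hne
  have hfin : Finite (G ⧸ H) := Finite.of_surjective _ H.mkQ_surjective
  have hcard : Nat.card (G ⧸ H) ≠ 1 := (Finite.one_lt_card).ne'
  obtain ⟨p, hp, hpd⟩ := Nat.exists_prime_and_dvd hcard
  have : Fact p.Prime := ⟨hp⟩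
  have hpG : p ∣ Nat.card G :=
    hpd.trans (AddSubgroup.card_dvd_of_surjective H.mkQ.toAddMonoidHom H.mkQ_surjective)
  have hsurj : Function.Surjective fun q : G ⧸ H => p • q := by
    intro q
    obtain ⟨v, rfl⟩ := H.mkQ_surjective q
    obtain ⟨w, hw⟩ := h p hp hpG v
    refine ⟨H.mkQ w, ?_⟩
    change p • H.mkQ w = H.mkQ v
    rw [← map_nsmul]
    exact ((Submodule.Quotient.eq H).mpr hw).symm
  have hinj := Finite.injective_iff_surjective.mpr hsurj
  obtain ⟨q, hq⟩ := exists_prime_addOrderOf_dvd_card' p hpd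
  have h0 : q = 0 := hinj (by
    change p • q = p • 0
    rw [smul_zero, ← hq, addOrderOf_nsmul_eq_zero])
  rw [h0, addOrderOf_zero] at hq
  exact hp.one_lt.ne hq

/-- Residues modulo distinct primes can be prescribed independently. -/
theorem exists_zmod_cast_eq (m : ℕ) (a : ∀ p : m.primeFactors, ZMod p) :
    ∃ x : ZMod m, ∀ p : m.primeFactors,
      ZMod.castHom (Nat.dvd_of_mem_primeFactors p.2) (ZMod p) x = a p := by
  have hpr : ∀ p : m.primeFactors, (p : ℕ).Prime := fun p => Nat.prime_of_mem_primeFactors p.2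
  obtain ⟨k, hk⟩ := Nat.chineseRemainderOfFinset (fun p : m.primeFactors => (a p).val)
    (fun p => (p : ℕ)) Finset.univ (fun p _ => (hpr p).ne_zero) (by
      intro p _ q _ hpq
      exact (Nat.coprime_primes (hpr p) (hpr q)).mpr fun h => hpq (Subtype.ext h))
  refine ⟨(k : ZMod m), fun p => ?_⟩
  have : NeZero (p : ℕ) := ⟨(hpr p).ne_zero⟩
  rw [map_natCast, (ZMod.natCast_eq_natCast_iff _ _ _).mpr (hk p (Finset.mem_univ _)),
    ZMod.natCast_zmod_val]

/-- A `(N × n)`-matrix over a field with linearly independent columns has rows that span. -/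
theorem span_rows_eq_top {K : Type*} [Field K] {n N : ℕ} (A : Fin n → Fin N → K)
    (hA : LinearIndependent K A) :
    Submodule.span K (Set.range fun j i => A i j) = ⊤ := by
  have h1 : (Matrix.of A).rank = n := by
    have := LinearIndependent.rank_matrix (M := Matrix.of A) hA
    simpa using this
  rw [← Matrix.rank_transpose, Matrix.rank_eq_finrank_span_row] at h1
  apply Submodule.eq_top_of_finrank_eq
  rw [Module.finrank_fin_fun]
  exact h1

/-- The proportion of linearly independent families among `n` vectors of `(ℤ/p)ⁿ⁺¹`. -/
theorem ncard_linearIndependent_zmod (n p : ℕ) [Fact p.Prime] :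
    ({A : Fin n → Fin (n + 1) → ZMod p | LinearIndependent (ZMod p) A}.ncard : ℝ) =
      (∏ i ∈ Finset.Icc 2 (n + 1), (1 - 1 / (p : ℝ) ^ i)) *
        Nat.card (Fin n → Fin (n + 1) → ZMod p) := by
  have hp0 : (p : ℝ) ≠ 0 := by exact_mod_cast (Fact.out : p.Prime).ne_zero
  have h := card_linearIndependent (K := ZMod p) (V := Fin (n + 1) → ZMod p) (k := n) (by simp)
  rw [← Set.coe_ofPred, Nat.card_coe_set_eq] at h
  rw [h, Module.finrank_fin_fun, ZMod.card]
  have e : ∏ i ∈ Finset.Icc 2 (n + 1), (1 - 1 / (p : ℝ) ^ i) =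
      ∏ i : Fin n, (1 - 1 / (p : ℝ) ^ (n + 1 - (i : ℕ))) := by
    rw [Fin.prod_univ_eq_prod_range (fun i => 1 - 1 / (p : ℝ) ^ (n + 1 - i)) n]
    refine Finset.prod_bij' (fun i _ => n + 1 - i) (fun i _ => n + 1 - i) ?_ ?_ ?_ ?_ ?_
    · intro i hi; simp only [Finset.mem_Icc, Finset.mem_range] at *; omega
    · intro i hi; simp only [Finset.mem_Icc, Finset.mem_range] at *; omega
    · intro i hi; simp only [Finset.mem_Icc] at *; omega
    · intro i hi; simp only [Finset.mem_range] at *; omega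
    · intro i hi
      simp only [Finset.mem_Icc] at hi
      congr 3; omega
  have hc : (Nat.card (Fin n → Fin (n + 1) → ZMod p) : ℝ) = ∏ _i : Fin n, (p : ℝ) ^ (n + 1) := by
    simp [Nat.card_eq_fintype_card, ZMod.card]
  rw [e, hc, ← Finset.prod_mul_distrib, Nat.cast_prod]
  refine Finset.prod_congr rfl fun i _ => ?_
  rw [Nat.cast_sub (Nat.pow_le_pow_right (Fact.out : p.Prime).pos (by omega))]
  push_cast
  have : (p : ℝ) ^ (n + 1) = p ^ (n + 1 - (i : ℕ)) * p ^ (i : ℕ) := by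
    rw [← pow_add]; congr 1; omega
  rw [this]
  field_simp

/-- Matrices over `ℤ/m` whose columns are linearly independent modulo each prime divisor of `m`
have proportion at least `∏ ζ(i)⁻¹`. -/
theorem invZetaProd_mul_card_le_ncard (n m : ℕ) (hm : m ≠ 0) :
    invZetaProd n * Nat.card (Fin n → Fin (n + 1) → ZMod m) ≤
      {A : Fin n → Fin (n + 1) → ZMod m | ∀ p : m.primeFactors,
        LinearIndependent (ZMod p) fun i j =>
          ZMod.castHom (Nat.dvd_of_mem_primeFactors p.2) (ZMod p) (A i j)}.ncard := by
  have : NeZero m := ⟨hm⟩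
  have hpr : ∀ p : m.primeFactors, Fact (p : ℕ).Prime := fun p =>
    ⟨Nat.prime_of_mem_primeFactors p.2⟩
  let C := ∀ p : m.primeFactors, Fin n → Fin (n + 1) → ZMod p
  let f : (Fin n → Fin (n + 1) → ZMod m) →+ C :=
    { toFun := fun A p i j => ZMod.castHom (Nat.dvd_of_mem_primeFactors p.2) (ZMod p) (A i j)
      map_zero' := by funext p i j; exact map_zero (ZMod.castHom _ _)
      map_add' := fun A A' => by funext p i j; exact map_add (ZMod.castHom _ _) _ _ }
  have hf : Function.Surjective f := by
    intro c
    choose A hA using fun i j => exists_zmod_cast_eq m fun p => c p i j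
    exact ⟨A, by funext p i j; exact hA i j p⟩
  let S : Set C := Set.univ.pi fun p => {A | LinearIndependent (ZMod p) A}
  have hS : (S.ncard : ℝ) = (∏ p : m.primeFactors,
      ∏ i ∈ Finset.Icc 2 (n + 1), (1 - 1 / ((p : ℕ) : ℝ) ^ i)) * Nat.card C := by
    have h1 : S.ncard = ∏ p : m.primeFactors,
        {A : Fin n → Fin (n + 1) → ZMod p | LinearIndependent (ZMod p) A}.ncard := by
      rw [← Nat.card_coe_set_eq, Nat.card_congr (Equiv.Set.univPi _), Nat.card_pi]
      simp only [Nat.card_coe_set_eq]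
    rw [h1, Nat.card_pi, Nat.cast_prod, Nat.cast_prod, ← Finset.prod_mul_distrib]
    exact Finset.prod_congr rfl fun p _ => ncard_linearIndependent_zmod n p
  have hpre : {A : Fin n → Fin (n + 1) → ZMod m | ∀ p : m.primeFactors,
        LinearIndependent (ZMod p) fun i j =>
          ZMod.castHom (Nat.dvd_of_mem_primeFactors p.2) (ZMod p) (A i j)} = f ⁻¹' S := by
    ext A
    exact ⟨fun h p _ => h p, fun h p => h p trivial⟩
  have hC : 0 < Nat.card C := by
    have : Finite C := Finite.of_surjective f hf
    exact Nat.card_pos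
  have hkey := f.ncard_preimage_mul_card hf S
  have hkey' : ((f ⁻¹' S).ncard : ℝ) * Nat.card C =
      S.ncard * Nat.card (Fin n → Fin (n + 1) → ZMod m) := by exact_mod_cast hkey
  rw [hpre]
  have hCr : (0 : ℝ) < Nat.card C := by exact_mod_cast hC
  refine le_of_mul_le_mul_right ?_ hCr
  rw [hkey', hS]
  have hz : invZetaProd n ≤
      ∏ p : m.primeFactors, ∏ i ∈ Finset.Icc 2 (n + 1), (1 - 1 / ((p : ℕ) : ℝ) ^ i) := by
    rw [Finset.prod_comm]
    refine Finset.prod_le_prod (fun i hi => inv_nonneg.mpr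
      (zero_le_one.trans (one_le_re_riemannZeta_nat (Finset.mem_Icc.mp hi).1))) fun i hi => ?_
    refine (inv_re_riemannZeta_le_prod_primes (Finset.mem_Icc.mp hi).1 m.primeFactors
      fun p hp => Nat.prime_of_mem_primeFactors hp).trans_eq ?_
    exact (Finset.prod_coe_sort m.primeFactors fun p : ℕ => 1 - 1 / (p : ℝ) ^ i).symm
  calc _ = invZetaProd n *
        (Nat.card (Fin n → Fin (n + 1) → ZMod m) * Nat.card C) := by ring
    _ ≤ _ := mul_le_mul_of_nonneg_right hz (by positivity)
    _ = _ := by ring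

/-- If the columns of `A` are linearly independent modulo each prime divisor of `m`, then the rows
of `A` generate `(ℤ/m)ⁿ`. -/
theorem span_rows_zmod_eq_top {n N m : ℕ} (hm : m ≠ 0) (A : Fin n → Fin N → ZMod m)
    (hA : ∀ p : m.primeFactors, LinearIndependent (ZMod p) fun i j =>
      ZMod.castHom (Nat.dvd_of_mem_primeFactors p.2) (ZMod p) (A i j)) :
    Submodule.span ℤ (Set.range fun j i => A i j) = ⊤ := by
  have : NeZero m := ⟨hm⟩
  refine span_eq_top_of_forall_prime _ fun p hp hpd v => ?_
  have hpm : p ∣ m := by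
    rw [Nat.card_pi] at hpd
    obtain ⟨-, -, h⟩ := (hp.prime.dvd_finsetProd_iff _).mp hpd
    simpa [Nat.card_eq_fintype_card] using h
  have : Fact p.Prime := ⟨hp⟩
  set φ := ZMod.castHom hpm (ZMod p) with hφ
  have htop := span_rows_eq_top _ (hA ⟨p, Nat.mem_primeFactors.mpr ⟨hp, hpm, hm⟩⟩)
  have hmem : (fun i => φ (v i)) ∈ Submodule.span (ZMod p)
      (Set.range fun (j : Fin N) (i : Fin n) => φ (A i j)) := by
    rw [htop]; exact Submodule.mem_top
  obtain ⟨c, hc⟩ := (Submodule.mem_span_range_iff_exists_fun _).mp hmem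
  have hdiv : ∀ i, ∃ w : ZMod m, v i - ∑ j, (c j).val * A i j = p • w := by
    intro i
    have h0 : φ (v i - ∑ j, ((c j).val : ZMod m) * A i j) = 0 := by
      have := congrFun hc i
      simp only [Finset.sum_apply, Pi.smul_apply, smul_eq_mul] at this
      rw [map_sub, map_sum, ← this, sub_eq_zero]
      refine Finset.sum_congr rfl fun j _ => ?_
      rw [map_mul, map_natCast, ZMod.natCast_zmod_val]
    set z := v i - ∑ j, ((c j).val : ZMod m) * A i j
    have hz : (z.val : ZMod p) = 0 := by
      rw [← map_natCast φ z.val, ZMod.natCast_zmod_val, h0]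
    obtain ⟨k, hk⟩ := (ZMod.natCast_eq_zero_iff _ _).mp hz
    refine ⟨k, ?_⟩
    rw [← ZMod.natCast_zmod_val z, hk]
    push_cast
    rw [nsmul_eq_mul]
  choose w hw using hdiv
  refine ⟨w, ?_⟩
  have e : v - p • w = ∑ j, ((c j).val : ℤ) • fun i => A i j := by
    funext i
    have := hw i
    simp only [Pi.sub_apply, Pi.smul_apply, Finset.sum_apply]
    rw [← this]
    simp
  rw [e]
  exact Submodule.sum_mem _ fun j _ => Submodule.smul_mem _ _ (Submodule.subset_span ⟨j, rfl⟩)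

/-- The case of a group killed by `m`, as a quotient of `(ℤ/m)ⁿ`: generating tuples of `(ℤ/m)ⁿ`
map to generating tuples, and the fibres of the quotient map have equal size. -/
theorem invZetaProd_mul_card_pow_le_of_module {G : Type*} [AddCommGroup G] [Finite G] (m : ℕ)
    [NeZero m] [Module (ZMod m) G] {n : ℕ}
    (e : Fin n → G) (he : Submodule.span ℤ (Set.range e) = ⊤) :
    invZetaProd n * (Nat.card G : ℝ) ^ (n + 1) ≤
      {g : Fin (n + 1) → G | Submodule.span ℤ (Set.range g) = ⊤}.ncard := by
  have hm : m ≠ 0 := NeZero.ne m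
  let φ : (Fin n → ZMod m) →ₗ[ZMod m] G := Fintype.linearCombination (ZMod m) e
  have hφ : Function.Surjective ⇑φ := by
    intro x
    have hx : x ∈ Submodule.span ℤ (Set.range e) := he ▸ Submodule.mem_top
    obtain ⟨c, rfl⟩ := (Submodule.mem_span_range_iff_exists_fun _).mp hx
    refine ⟨fun i => (c i : ZMod m), ?_⟩
    simp only [φ, Fintype.linearCombination_apply]
    exact Finset.sum_congr rfl fun i _ => Int.cast_smul_eq_zsmul _ _ _
  let f : (Fin n → Fin (n + 1) → ZMod m) →+ (Fin (n + 1) → G) :=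
    { toFun := fun A j => φ fun i => A i j
      map_zero' := by funext j; exact map_zero φ
      map_add' := fun A A' => by funext j; exact map_add φ _ _ }
  have hf : Function.Surjective f := by
    intro g
    choose a ha using fun j => hφ (g j)
    exact ⟨fun i j => a j i, funext ha⟩
  set T := {g : Fin (n + 1) → G | Submodule.span ℤ (Set.range g) = ⊤}
  have hsub : {A : Fin n → Fin (n + 1) → ZMod m | ∀ p : m.primeFactors,
        LinearIndependent (ZMod p) fun i j =>
          ZMod.castHom (Nat.dvd_of_mem_primeFactors p.2) (ZMod p) (A i j)} ⊆ f ⁻¹' T := by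
    intro A hA
    have h := span_rows_zmod_eq_top hm A hA
    have h2 := congrArg (Submodule.map φ.toAddMonoidHom.toIntLinearMap) h
    rw [Submodule.map_span, ← Set.range_comp, Submodule.map_top,
      (LinearMap.range_eq_top (f := φ.toAddMonoidHom.toIntLinearMap)).mpr hφ] at h2
    exact h2
  have h1 := invZetaProd_mul_card_le_ncard n m hm
  have h2 : (_ : ℝ) ≤ _ := Nat.cast_le.mpr (Set.ncard_le_ncard hsub (Set.toFinite _))
  have h3 : ((f ⁻¹' T).ncard : ℝ) * Nat.card (Fin (n + 1) → G) =
      T.ncard * Nat.card (Fin n → Fin (n + 1) → ZMod m) := by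
    exact_mod_cast f.ncard_preimage_mul_card hf T
  have hc : (Nat.card (Fin (n + 1) → G) : ℝ) = (Nat.card G : ℝ) ^ (n + 1) := by
    simp [Nat.card_pi]
  have hpos : (0 : ℝ) < Nat.card (Fin n → Fin (n + 1) → ZMod m) := by exact_mod_cast Nat.card_pos
  rw [← hc]
  refine le_of_mul_le_mul_right ?_ hpos
  rw [← h3, mul_right_comm]
  exact mul_le_mul_of_nonneg_right (h1.trans h2) (by positivity)

/-- In a finite abelian group generated by `n` elements, the proportion of generating
`(n + 1)`-tuples is at least `∏ ζ(i)⁻¹`. -/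
theorem invZetaProd_mul_card_pow_le {G : Type*} [AddCommGroup G] [Finite G] {n : ℕ}
    (e : Fin n → G) (he : Submodule.span ℤ (Set.range e) = ⊤) :
    invZetaProd n * (Nat.card G : ℝ) ^ (n + 1) ≤
      {g : Fin (n + 1) → G | Submodule.span ℤ (Set.range g) = ⊤}.ncard := by
  have : NeZero (Nat.card G) := ⟨Nat.card_pos.ne'⟩
  let _ : Module (ZMod (Nat.card G)) G := AddCommGroup.zmodModule fun x => card_nsmul_eq_zero'
  exact invZetaProd_mul_card_pow_le_of_module (Nat.card G) e he

/-! ### Tiles of a lattice -/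

/-- A measurable set `F` whose translates by the vectors of `M` partition the space. -/
structure IsTile {n : ℕ} (M : Submodule ℤ (EuclideanSpace ℝ (Fin n)))
    (F : Set (EuclideanSpace ℝ (Fin n))) : Prop where
  measurableSet : MeasurableSet F
  exists_sub_mem : ∀ x, ∃ v ∈ M, x - v ∈ F
  eq_zero_of_add_mem : ∀ v ∈ M, ∀ x ∈ F, x + v ∈ F → v = 0

theorem isTile_fundamentalDomain {n : ℕ} {ι : Type*} [Fintype ι]
    (b : Module.Basis ι ℝ (EuclideanSpace ℝ (Fin n))) :
    IsTile (Submodule.span ℤ (Set.range b)) (ZSpan.fundamentalDomain b) where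
  measurableSet := ZSpan.fundamentalDomain_measurableSet b
  exists_sub_mem x := ⟨ZSpan.floor b x, (ZSpan.floor b x).2, ZSpan.fract_mem_fundamentalDomain b x⟩
  eq_zero_of_add_mem v hv x hx hxv := by
    obtain ⟨w, -, hw⟩ := ZSpan.exist_unique_vadd_mem_fundamentalDomain b x
    have h0 := hw 0 (by simpa using hx)
    have h1 := hw ⟨v, hv⟩ (by
      change v + x ∈ _
      rwa [add_comm])
    simpa using congrArg Subtype.val (h1.trans h0.symm)

section Tile

variable {n : ℕ} {L M : Submodule ℤ (EuclideanSpace ℝ (Fin n))}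
  {F A : Set (EuclideanSpace ℝ (Fin n))}

/-- Translates of a tile by points of one coset of `M` do not overlap, so their volumes add up.
The points are taken from a larger lattice `L`, so that this applies to each coset in `L / M`. -/
theorem IsTile.card_mul_volume_le (hF : IsTile M F) (T : Finset L)
    (hT : ∀ s ∈ T, ∀ t ∈ T, (s : EuclideanSpace ℝ (Fin n)) - t ∈ M)
    (hA : ∀ t ∈ T, ∀ f ∈ F, (t : EuclideanSpace ℝ (Fin n)) + f ∈ A) :
    T.card * volume F ≤ volume A := by
  have hmeas : ∀ t : L, volume ((fun x => x + -(t : EuclideanSpace ℝ (Fin n))) ⁻¹' F) = volume F :=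
    fun t => measure_preimage_add_right _ _ _
  have hdisj : Set.PairwiseDisjoint (T : Set L)
      (fun t : L => (fun x => x + -(t : EuclideanSpace ℝ (Fin n))) ⁻¹' F) := by
    intro s hs t ht hst
    rw [Function.onFun, Set.disjoint_left]
    intro x hxs hxt
    refine hst (Subtype.ext (sub_eq_zero.mp ?_))
    refine hF.eq_zero_of_add_mem _ (hT s hs t ht) _ hxs ?_
    have e : x + -(s : EuclideanSpace ℝ (Fin n)) + (s - t) =
        x + -(t : EuclideanSpace ℝ (Fin n)) := by
      abel
    rw [e]; exact hxt
  calc (T.card : ENNReal) * volume F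
      = ∑ t ∈ T, volume ((fun x => x + -(t : EuclideanSpace ℝ (Fin n))) ⁻¹' F) := by
        simp [hmeas]
    _ = volume (⋃ t ∈ T, (fun x => x + -(t : EuclideanSpace ℝ (Fin n))) ⁻¹' F) :=
        (measure_biUnion_finset hdisj fun t _ => measurable_add_const _ hF.measurableSet).symm
    _ ≤ volume A := measure_mono (Set.iUnion₂_subset fun t ht x hx => by
        have := hA t ht _ hx
        simpa using this)

theorem volume_le_card_mul (T : Finset L)
    (hA : ∀ x ∈ A, ∃ t ∈ T, x - (t : EuclideanSpace ℝ (Fin n)) ∈ F) :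
    volume A ≤ T.card * volume F := by
  have hmeas : ∀ t : L, volume ((fun x => x + -(t : EuclideanSpace ℝ (Fin n))) ⁻¹' F) = volume F :=
    fun t => measure_preimage_add_right _ _ _
  calc volume A ≤ volume (⋃ t ∈ T, (fun x => x + -(t : EuclideanSpace ℝ (Fin n))) ⁻¹' F) :=
        measure_mono fun x hx => by
          obtain ⟨t, ht, h⟩ := hA x hx
          exact Set.mem_iUnion₂.mpr ⟨t, ht, by rw [sub_eq_add_neg] at h; exact h⟩
    _ ≤ ∑ t ∈ T, volume ((fun x => x + -(t : EuclideanSpace ℝ (Fin n))) ⁻¹' F) :=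
        measure_biUnion_finset_le _ _
    _ = _ := by simp [hmeas]

theorem IsTile.volume_ne_zero [Countable M] (hF : IsTile M F) : volume F ≠ 0 := by
  intro h0
  have huniv : (Set.univ : Set (EuclideanSpace ℝ (Fin n))) ⊆
      ⋃ v : M, (fun x => x + -(v : EuclideanSpace ℝ (Fin n))) ⁻¹' F := fun x _ => by
    obtain ⟨v, hv, h⟩ := hF.exists_sub_mem x
    exact Set.mem_iUnion.mpr ⟨⟨v, hv⟩, by rw [sub_eq_add_neg] at h; exact h⟩
  have : volume (Set.univ : Set (EuclideanSpace ℝ (Fin n))) = 0 :=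
    measure_mono_null huniv (measure_iUnion_null fun v => by
      rw [measure_preimage_add_right]; exact h0)
  exact (NeZero.ne (volume : Measure (EuclideanSpace ℝ (Fin n))))
    (Measure.measure_univ_eq_zero.mp this)

/-- A set that meets every coset of a lattice contains a tile: from each coset, represented by a
point of a given tile `F`, select the point of `S` that comes first for a fixed enumeration of the
lattice. -/
theorem IsTile.exists_subset [Countable M] (hF : IsTile M F)
    {S : Set (EuclideanSpace ℝ (Fin n))}
    (hS : MeasurableSet S) (hcov : ∀ x, ∃ v ∈ M, x - v ∈ S) :
    ∃ F', IsTile M F' ∧ F' ⊆ S := by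
  classical
  obtain ⟨c, hc⟩ := exists_injective_nat M
  refine ⟨⋃ v : M, (S ∩ (fun x => x + (v : EuclideanSpace ℝ (Fin n))) ⁻¹' F) ∩
    ⋂ (w : M) (_ : c w < c v),
      (fun x => x + ((v : EuclideanSpace ℝ (Fin n)) - w)) ⁻¹' Sᶜ, ⟨?_, ?_, ?_⟩, ?_⟩
  · refine MeasurableSet.iUnion fun v => (hS.inter (measurable_add_const _ hF.measurableSet)).inter
      (MeasurableSet.iInter fun w => MeasurableSet.iInter fun _ =>
        measurable_add_const _ hS.compl)
  · intro x
    obtain ⟨u, hu, hxu⟩ := hF.exists_sub_mem x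
    have hex : ∃ k, ∃ v : M, c v = k ∧ x - u - v ∈ S := by
      obtain ⟨v, hv, h⟩ := hcov (x - u)
      exact ⟨_, ⟨v, hv⟩, rfl, h⟩
    obtain ⟨v, hvk, hv⟩ := Nat.find_spec hex
    refine ⟨u + v, M.add_mem hu v.2, Set.mem_iUnion.mpr ⟨v, ⟨?_, ?_⟩, ?_⟩⟩
    · rw [← sub_sub]; exact hv
    · change x - (u + v) + v ∈ F
      rw [← sub_sub, sub_add_cancel]; exact hxu
    · refine Set.mem_iInter₂.mpr fun w hw => ?_
      change x - (u + v) + (v - w) ∉ S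
      have e : x - (u + v) + (v - w) = x - u - w := by abel
      rw [e]
      intro h
      exact Nat.find_min hex (hvk ▸ hw) ⟨w, rfl, h⟩
  · intro d hd x hx hxd
    obtain ⟨v, ⟨hxS, hxv⟩, hvmin⟩ := Set.mem_iUnion.mp hx
    obtain ⟨w, ⟨hxdS, hxw⟩, hwmin⟩ := Set.mem_iUnion.mp hxd
    have hxv' : x + v ∈ F := hxv
    have hxw' : x + d + w ∈ F := hxw
    have h1 : d + w - v = 0 := hF.eq_zero_of_add_mem _ (M.sub_mem (M.add_mem hd w.2) v.2) _ hxv' (by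
      have e : x + v + (d + w - v) = x + d + w := by abel
      rw [e]; exact hxw')
    have hd' : d = v - w := by
      have e : d = (d + w - v) + (v - w) := by abel
      rw [e, h1, zero_add]
    have hvw : c v = c w := by
      rcases lt_trichotomy (c v) (c w) with h | h | h
      · refine absurd hxS (?_ : x ∉ S)
        have := Set.mem_iInter₂.mp hwmin v h
        change x + d + (w - v) ∉ S at this
        have e : x + d + (w - v) = x := by rw [hd']; abel
        rwa [e] at this
      · exact h
      · refine absurd hxdS (?_ : x + d ∉ S)
        have := Set.mem_iInter₂.mp hvmin w h
        change x + (v - w) ∉ S at this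
        rwa [hd']
    rw [hd', hc hvw, sub_self]
  · exact Set.iUnion_subset fun v x hx => hx.1.1

end Tile

section Lattice

variable {n : ℕ} (L : Submodule ℤ (EuclideanSpace ℝ (Fin n)))

theorem exists_isTile_isBounded [DiscreteTopology L] [IsZLattice ℝ L] : ∃ F, IsTile L F ∧ Bornology.IsBounded F := by
  have : Module.Free ℤ L := ZLattice.module_free ℝ L
  have : Module.Finite ℤ L := ZLattice.module_finite ℝ L
  let b := (Module.Free.chooseBasis ℤ L).ofZLatticeBasis ℝ L
  refine ⟨ZSpan.fundamentalDomain b, ?_, ZSpan.fundamentalDomain_isBounded b⟩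
  have h := isTile_fundamentalDomain b
  rwa [Module.Basis.ofZLatticeBasis_span] at h

theorem countable_lattice [DiscreteTopology L] [IsZLattice ℝ L] : Countable L := by
  have : Module.Finite ℤ L := ZLattice.module_finite ℝ L
  infer_instance

theorem coveringRadius_nonneg : 0 ≤ coveringRadius L :=
  Real.iSup_nonneg fun _ => Metric.infDist_nonneg

/-- The distances to the lattice are bounded, as a tile is; otherwise the supremum that defines the
covering radius would be the junk value `0`. -/
theorem infDist_le_coveringRadius [DiscreteTopology L] [IsZLattice ℝ L] (x : EuclideanSpace ℝ (Fin n)) :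
    Metric.infDist x (L : Set (EuclideanSpace ℝ (Fin n))) ≤ coveringRadius L := by
  obtain ⟨F, hF, hbd⟩ := exists_isTile_isBounded L
  obtain ⟨R, hR⟩ := hbd.exists_norm_le
  refine le_ciSup (f := fun x => Metric.infDist x (L : Set (EuclideanSpace ℝ (Fin n))))
    ⟨R, ?_⟩ x
  rintro _ ⟨y, rfl⟩
  obtain ⟨v, hv, h⟩ := hF.exists_sub_mem y
  refine (Metric.infDist_le_dist_of_mem hv).trans ?_
  rw [dist_eq_norm]
  exact hR _ h

/-- A lattice has a tile within the closed ball whose radius is the covering radius. -/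
theorem exists_isTile_subset_closedBall [DiscreteTopology L] [IsZLattice ℝ L] :
    ∃ F, IsTile L F ∧ F ⊆ Metric.closedBall 0 (coveringRadius L) := by
  obtain ⟨F, hF, -⟩ := exists_isTile_isBounded L
  have := countable_lattice L
  refine hF.exists_subset Metric.isClosed_closedBall.measurableSet fun x => ?_
  have hcl : IsClosed (L : Set (EuclideanSpace ℝ (Fin n))) :=
    AddSubgroup.isClosed_of_discrete (H := L.toAddSubgroup)
  obtain ⟨v, hv, h⟩ := hcl.exists_infDist_eq_dist ⟨0, L.zero_mem⟩ x
  refine ⟨v, hv, ?_⟩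
  rw [mem_closedBall_zero_iff, ← dist_eq_norm, ← h]
  exact infDist_le_coveringRadius L x

/-- A tile within the ball of radius `0` would be a null set. -/
theorem coveringRadius_pos [DiscreteTopology L] [IsZLattice ℝ L] (hn : 1 ≤ n) : 0 < coveringRadius L := by
  refine (coveringRadius_nonneg L).lt_of_ne fun h0 => ?_
  obtain ⟨F, hF, hsub⟩ := exists_isTile_subset_closedBall L
  have := countable_lattice L
  rw [← h0, Metric.closedBall_zero] at hsub
  have : Nonempty (Fin n) := ⟨⟨0, hn⟩⟩
  have : Nontrivial (EuclideanSpace ℝ (Fin n)) := inferInstance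
  exact hF.volume_ne_zero (measure_mono_null hsub (measure_singleton 0))

theorem finite_window [DiscreteTopology L] (B : ℝ) :
    {v : L | (v : EuclideanSpace ℝ (Fin n)) ∈ window n B}.Finite := by
  have hbd : Bornology.IsBounded (window n B) := by
    refine (Metric.isBounded_closedBall (x := (0 : EuclideanSpace ℝ (Fin n)))
      (r := √(∑ _i : Fin n, B ^ 2))).subset fun x hx => ?_
    rw [mem_closedBall_zero_iff, EuclideanSpace.norm_eq]
    refine Real.sqrt_le_sqrt (Finset.sum_le_sum fun i _ => ?_)
    rw [Real.norm_of_nonneg (hx i).1]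
    exact pow_le_pow_left₀ (hx i).1 (hx i).2.le 2
  have hcl : IsClosed (L : Set (EuclideanSpace ℝ (Fin n))) :=
    AddSubgroup.isClosed_of_discrete (H := L.toAddSubgroup)
  have h := Metric.finite_isBounded_inter_isClosed (s := (L : Set (EuclideanSpace ℝ (Fin n))))
    (isDiscrete_iff_discreteTopology.mpr inferInstance) hbd hcl
  exact Set.Finite.of_finite_image (f := Subtype.val)
    (h.subset (by rintro _ ⟨v, hv, rfl⟩; exact ⟨hv, v.2⟩)) Subtype.val_injective.injOn

end Lattice

/-! ### Volumes of boxes -/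

theorem volume_setOf_forall_apply_mem {n : ℕ} (s : Fin n → Set ℝ) (hs : ∀ i, MeasurableSet (s i)) :
    volume {x : EuclideanSpace ℝ (Fin n) | ∀ i, x i ∈ s i} = ∏ i, volume (s i) := by
  have h := (EuclideanSpace.volume_preserving_symm_measurableEquiv_toLp (Fin n)).measure_preimage
    (s := Set.univ.pi s) (MeasurableSet.univ_pi hs).nullMeasurableSet
  rw [← volume_pi_pi, ← h]
  congr 1
  ext x
  exact ⟨fun h i _ => h i, fun h i => h i trivial⟩

theorem measurableSet_setOf_forall_apply_mem {n : ℕ} (s : Fin n → Set ℝ)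
    (hs : ∀ i, MeasurableSet (s i)) :
    MeasurableSet {x : EuclideanSpace ℝ (Fin n) | ∀ i, x i ∈ s i} := by
  have h := (MeasurableEquiv.toLp 2 (Fin n → ℝ)).symm.measurable (MeasurableSet.univ_pi hs)
  convert h using 1
  ext x
  exact ⟨fun h i _ => h i, fun h i => h i trivial⟩

theorem OrthonormalBasis.volume_setOf_forall_repr_mem {n : ℕ}
    (b : OrthonormalBasis (Fin n) ℝ (EuclideanSpace ℝ (Fin n)))
    (s : Fin n → Set ℝ) (hs : ∀ i, MeasurableSet (s i)) :
    volume {x : EuclideanSpace ℝ (Fin n) | ∀ i, b.repr x i ∈ s i} = ∏ i, volume (s i) := by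
  rw [← volume_setOf_forall_apply_mem s hs]
  exact b.measurePreserving_repr.measure_preimage
    (measurableSet_setOf_forall_apply_mem s hs).nullMeasurableSet

/-! ### Lattice points of the window in a subspace -/

section Window

variable {n : ℕ} {L : Submodule ℤ (EuclideanSpace ℝ (Fin n))}
  {F : Set (EuclideanSpace ℝ (Fin n))}

theorem abs_apply_le_norm (x : EuclideanSpace ℝ (Fin n)) (i : Fin n) : |x i| ≤ ‖x‖ := by
  rw [← Real.norm_eq_abs]; exact PiLp.norm_apply_le x i

theorem volume_cube (a b : ℝ) :
    volume {x : EuclideanSpace ℝ (Fin n) | ∀ i, x i ∈ Set.Ico a b} =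
      ENNReal.ofReal (b - a) ^ n := by
  rw [volume_setOf_forall_apply_mem (fun _ => Set.Ico a b) fun _ => measurableSet_Ico]
  simp

/-- The cube `[ν, B - ν)ⁿ` is covered by the tiles at the lattice points of `[0, B)ⁿ`. -/
theorem ofReal_sub_pow_le_card_mul {ν B : ℝ} (hF : IsTile L F)
    (hν : F ⊆ Metric.closedBall 0 ν) (S : Finset L)
    (hS : ∀ v : L, (v : EuclideanSpace ℝ (Fin n)) ∈ window n B → v ∈ S) :
    ENNReal.ofReal (B - 2 * ν) ^ n ≤ S.card * volume F := by
  rw [show B - 2 * ν = (B - ν) - ν by ring, ← volume_cube]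
  refine volume_le_card_mul S fun x hx => ?_
  obtain ⟨v, hv, h⟩ := hF.exists_sub_mem x
  refine ⟨⟨v, hv⟩, hS _ fun i => ?_, h⟩
  have h1 := (abs_apply_le_norm (x - v) i).trans (mem_closedBall_zero_iff.mp (hν h))
  rw [PiLp.sub_apply, abs_le] at h1
  have h2 := hx i
  simp only [Set.mem_Ico] at h2 ⊢
  constructor <;> linarith

/-- Given `k` vectors, there is an orthonormal basis whose vectors from the `k`-th on are
orthogonal to all of them: apply Gram-Schmidt to the family continued by zero. -/
theorem exists_orthonormalBasis_inner_eq_zero {k : ℕ} (hk : k ≤ n)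
    (w : Fin k → EuclideanSpace ℝ (Fin n)) :
    ∃ b : OrthonormalBasis (Fin n) ℝ (EuclideanSpace ℝ (Fin n)),
      ∀ i : Fin n, k ≤ (i : ℕ) → ∀ v ∈ Submodule.span ℝ (Set.range w), inner ℝ (b i) v = 0 := by
  let f : Fin n → EuclideanSpace ℝ (Fin n) := fun i => if h : (i : ℕ) < k then w ⟨i, h⟩ else 0
  let b := InnerProductSpace.gramSchmidtOrthonormalBasis (𝕜 := ℝ) (by simp) f
  refine ⟨b, fun i hi v hv => ?_⟩
  have hzero : InnerProductSpace.gramSchmidtNormed ℝ f i = 0 := by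
    have : InnerProductSpace.gramSchmidt ℝ f i = 0 := by
      rw [InnerProductSpace.gramSchmidt_def]
      have : f i = 0 := by simp [f, hi]
      simp [this]
    simp [InnerProductSpace.gramSchmidtNormed, this]
  have hw : ∀ j, inner ℝ (b i) (w j) = 0 := fun j => by
    have h := InnerProductSpace.inner_gramSchmidtOrthonormalBasis_eq_zero (𝕜 := ℝ) (by simp)
      hzero ⟨j, j.2.trans_le hk⟩
    have e : f ⟨j, j.2.trans_le hk⟩ = w j := by simp [f]
    rwa [e] at h
  induction hv using Submodule.span_induction with
  | mem x hx => obtain ⟨j, rfl⟩ := hx; exact hw j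
  | zero => simp
  | add x y _ _ hx hy => rw [inner_add_right, hx, hy, add_zero]
  | smul a x _ hx => rw [inner_smul_right, hx, mul_zero]

/-- The points of the window stay within half the diagonal of its centre. -/
theorem norm_sub_center_le {B : ℝ} (hB : 0 ≤ B) {v : EuclideanSpace ℝ (Fin n)}
    (hv : v ∈ window n B) :
    ‖(v - WithLp.toLp 2 fun _ => B / 2 : EuclideanSpace ℝ (Fin n))‖ ≤ √(n : ℝ) * B / 2 := by
  rw [EuclideanSpace.norm_eq]
  calc √(∑ i, ‖(v - WithLp.toLp 2 fun _ => B / 2 : EuclideanSpace ℝ (Fin n)) i‖ ^ 2)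
      ≤ √(∑ _i : Fin n, (B / 2) ^ 2) := by
        refine Real.sqrt_le_sqrt (Finset.sum_le_sum fun i _ => ?_)
        have h := hv i
        refine pow_le_pow_left₀ (norm_nonneg _) ?_ 2
        rw [Real.norm_eq_abs, PiLp.sub_apply, abs_le]
        simp only [Set.mem_Ico] at h ⊢
        constructor <;> linarith
    _ = √(n : ℝ) * B / 2 := by
        rw [Finset.sum_const, Finset.card_univ, Fintype.card_fin, nsmul_eq_mul,
          Real.sqrt_mul (by positivity), Real.sqrt_sq (by positivity)]
        ring

/-- The tiles at lattice points of the window in a `k`-dimensional subspace lie in a box with `k`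
sides of length `√n (B + 2ν)` and `n - k` sides of length `2ν`. -/
theorem card_mul_volume_le_of_mem_span {ν B : ℝ} (hn : 1 ≤ n) (hB : 0 ≤ B) (hν0 : 0 ≤ ν)
    (hF : IsTile L F)
    (hν : F ⊆ Metric.closedBall 0 ν) {k : ℕ} (hk : k ≤ n) (w : Fin k → EuclideanSpace ℝ (Fin n))
    (T : Finset L)
    (hT : ∀ v ∈ T, (v : EuclideanSpace ℝ (Fin n)) ∈ window n B ∧
      (v : EuclideanSpace ℝ (Fin n)) ∈ Submodule.span ℝ (Set.range w)) :
    T.card * volume F ≤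
      ENNReal.ofReal (√(n : ℝ) * (B + 2 * ν)) ^ k * ENNReal.ofReal (2 * ν) ^ (n - k) := by
  obtain ⟨b, hb⟩ := exists_orthonormalBasis_inner_eq_zero hk w
  have ha1 : 1 ≤ √(n : ℝ) := by simpa using one_le_sqrt_pow hn 1
  set c : EuclideanSpace ℝ (Fin n) := WithLp.toLp 2 fun _ => B / 2
  set R : ℝ := √(n : ℝ) * (B + 2 * ν) / 2 with hR
  let s : Fin n → Set ℝ := fun i =>
    if (i : ℕ) < k then Set.Icc (inner ℝ (b i) c - R) (inner ℝ (b i) c + R) else Set.Icc (-ν) ν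
  have hs : ∀ i, MeasurableSet (s i) := fun i => by
    simp only [s]; split_ifs <;> exact measurableSet_Icc
  have hinner : ∀ i x, |inner ℝ (b i) x| ≤ ‖x‖ := fun i x => by
    have := abs_real_inner_le_norm (b i) x
    rwa [b.orthonormal.1 i, one_mul] at this
  refine (hF.card_mul_volume_le (A := {x | ∀ i, b.repr x i ∈ s i}) T
    (fun s _ t _ => L.sub_mem s.2 t.2) ?_).trans_eq ?_
  · intro v hv f hf i
    have hfν : |inner ℝ (b i) f| ≤ ν := (hinner i f).trans (mem_closedBall_zero_iff.mp (hν hf))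
    rw [OrthonormalBasis.repr_apply_apply, inner_add_right]
    rw [abs_le] at hfν
    by_cases hi : (i : ℕ) < k
    · have hvc := (hinner i _).trans (norm_sub_center_le hB (hT v hv).1)
      rw [inner_sub_right, abs_le] at hvc
      simp only [s, hi, if_true, Set.mem_Icc]
      have hR' : √(n : ℝ) * B / 2 + ν ≤ R := by rw [hR]; nlinarith
      constructor <;> linarith [hvc.1, hvc.2]
    · simp only [s, hi, if_false, Set.mem_Icc]
      rw [hb i (by omega) _ (hT v hv).2, zero_add]
      exact hfν
  · rw [OrthonormalBasis.volume_setOf_forall_repr_mem b s hs]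
    have e : ∀ i : Fin n, volume (s i) = (fun j : ℕ => if j < k then
        ENNReal.ofReal (√(n : ℝ) * (B + 2 * ν)) else ENNReal.ofReal (2 * ν)) i := fun i => by
      simp only [s]
      split_ifs
      · rw [Real.volume_Icc]; congr 1; rw [hR]; ring
      · rw [Real.volume_Icc]; congr 1; ring
    rw [Finset.prod_congr rfl fun i _ => e i,
      Fin.prod_univ_eq_prod_range (fun j : ℕ => if j < k then
        ENNReal.ofReal (√(n : ℝ) * (B + 2 * ν)) else ENNReal.ofReal (2 * ν))]
    obtain ⟨m, rfl⟩ := Nat.exists_eq_add_of_le hk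
    rw [Finset.prod_range_add, Nat.add_sub_cancel_left]
    congr 1
    · rw [Finset.prod_congr rfl fun i hi => if_pos (Finset.mem_range.mp hi)]; simp
    · simp

end Window

theorem IsTile.toReal_volume_pos {n : ℕ} {M : Submodule ℤ (EuclideanSpace ℝ (Fin n))} [Countable M]
    {F : Set (EuclideanSpace ℝ (Fin n))} (hF : IsTile M F) (hbd : Bornology.IsBounded F) :
    0 < (volume F).toReal :=
  ENNReal.toReal_pos hF.volume_ne_zero hbd.measure_lt_top.ne

/-- Among the lattice points of the window, those in the span of `k` vectors have proportion at
most `subspaceBound n k`: the volume `V` of a tile cancels from the two counts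
`card_mul_volume_le_of_mem_span` and `ofReal_sub_pow_le_card_mul`. -/
theorem card_le_subspaceBound_mul {n : ℕ} (hn : 1 ≤ n)
    (L : Submodule ℤ (EuclideanSpace ℝ (Fin n))) [DiscreteTopology L] [IsZLattice ℝ L] {B : ℝ}
    (hB : 8 * (n : ℝ) ^ ((n : ℝ) / 2) * coveringRadius L ≤ B) (S : Finset L)
    (hS : ∀ v : L, v ∈ S ↔ (v : EuclideanSpace ℝ (Fin n)) ∈ window n B) {k : ℕ} (hk : k ≤ n)
    (w : Fin k → EuclideanSpace ℝ (Fin n)) (T : Finset L) (hTS : T ⊆ S)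
    (hT : ∀ v ∈ T, (v : EuclideanSpace ℝ (Fin n)) ∈ Submodule.span ℝ (Set.range w)) :
    (T.card : ℝ) ≤ subspaceBound n k * S.card := by
  obtain ⟨F, hF, hsub⟩ := exists_isTile_subset_closedBall L
  have := countable_lattice L
  have hV := hF.toReal_volume_pos (Metric.isBounded_closedBall.subset hsub)
  have hVtop : volume F ≠ ⊤ := (Metric.isBounded_closedBall.subset hsub).measure_lt_top.ne
  have hν := coveringRadius_pos L hn
  set ν := coveringRadius L
  rw [rpow_natCast_div_two] at hB
  have hN1 := one_le_sqrt_pow hn n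
  rw [subspaceBound_eq]
  set N := √(n : ℝ) ^ n
  clear_value N ν
  have hB' : 4 * N * (2 * ν) ≤ B := by linarith
  have hB0 : 2 * ν < B := by nlinarith
  have hup := card_mul_volume_le_of_mem_span hn (by linarith) hν.le hF hsub hk w T
    fun v hv => ⟨(hS v).mp (hTS hv), hT v hv⟩
  have hlow := ofReal_sub_pow_le_card_mul hF hsub S fun v hv => (hS v).mpr hv
  set V := (volume F).toReal with hVdef
  have hVe : volume F = ENNReal.ofReal V := (ENNReal.ofReal_toReal hVtop).symm
  clear_value V
  have hBν : 0 ≤ B + 2 * ν := by linarith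
  have hup' : T.card * V ≤ (√(n : ℝ) * (B + 2 * ν)) ^ k * (2 * ν) ^ (n - k) := by
    rw [hVe, ← ENNReal.ofReal_pow (by positivity), ← ENNReal.ofReal_pow (by positivity),
      ← ENNReal.ofReal_mul (by positivity), ← ENNReal.ofReal_natCast,
      ← ENNReal.ofReal_mul (Nat.cast_nonneg _)] at hup
    exact (ENNReal.ofReal_le_ofReal_iff (by positivity)).mp hup
  have hlow' : (B - 2 * ν) ^ n ≤ S.card * V := by
    rw [hVe, ← ENNReal.ofReal_pow (by linarith), ← ENNReal.ofReal_natCast,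
      ← ENNReal.ofReal_mul (Nat.cast_nonneg _)] at hlow
    exact (ENNReal.ofReal_le_ofReal_iff (mul_nonneg (Nat.cast_nonneg _) hV.le)).mp hlow
  set D := B - 2 * ν with hD
  clear_value D
  have hD0 : 0 < D := by linarith
  have h4 : 0 < 4 * N - 1 := by linarith
  have h1 : 2 * ν ≤ D / (4 * N - 1) := by
    rw [le_div_iff₀ h4]; linarith
  have h2 : B + 2 * ν ≤ (4 * N + 1) * D / (4 * N - 1) := by
    rw [le_div_iff₀ h4]; nlinarith
  refine le_of_mul_le_mul_right ?_ hV
  calc T.card * V ≤ (√(n : ℝ) * (B + 2 * ν)) ^ k * (2 * ν) ^ (n - k) := hup'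
    _ ≤ (√(n : ℝ) * ((4 * N + 1) * D / (4 * N - 1))) ^ k * (D / (4 * N - 1)) ^ (n - k) := by
      gcongr
    _ = √(n : ℝ) ^ k * ((4 * N + 1) ^ k / (4 * N - 1) ^ n) * D ^ n := by
      obtain ⟨m, rfl⟩ := Nat.exists_eq_add_of_le hk
      rw [Nat.add_sub_cancel_left, pow_add, pow_add]
      simp only [mul_pow, div_pow]
      field_simp
    _ ≤ √(n : ℝ) ^ k * ((4 * N + 1) ^ k / (4 * N - 1) ^ n) * (S.card * V) := by
      gcongr
    _ = _ := by ring

open Classical in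
/-- Choosing the vectors one after the other, the `k`-th avoids the span of the previous ones. -/
theorem card_linearIndependent_ge {n : ℕ} (hn : 1 ≤ n)
    (L : Submodule ℤ (EuclideanSpace ℝ (Fin n))) [DiscreteTopology L] [IsZLattice ℝ L] {B : ℝ}
    (hB : 8 * (n : ℝ) ^ ((n : ℝ) / 2) * coveringRadius L ≤ B) (S : Finset L)
    (hS : ∀ v : L, v ∈ S ↔ (v : EuclideanSpace ℝ (Fin n)) ∈ window n B) {k : ℕ} (hk : k ≤ n) :
    (S.card : ℝ) ^ k * ∏ i ∈ Finset.range k, (1 - subspaceBound n i) ≤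
      ((Fintype.piFinset fun _ : Fin k => S).filter fun x =>
        LinearIndependent ℝ fun i => (x i : EuclideanSpace ℝ (Fin n))).card := by
  induction k with
  | zero =>
    have : LinearIndependent ℝ fun i : Fin 0 =>
      ((default : Fin 0 → L) i : EuclideanSpace ℝ (Fin n)) := linearIndependent_empty_type
    simp
  | succ k ih =>
    have ih := ih (by omega)
    set G := (Fintype.piFinset fun _ : Fin k => S).filter fun x =>
        LinearIndependent ℝ fun i => (x i : EuclideanSpace ℝ (Fin n)) with hG
    let bad : (Fin k → L) → Finset L := fun x => S.filter fun v =>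
      (v : EuclideanSpace ℝ (Fin n)) ∈ Submodule.span ℝ
        (Set.range fun i => (x i : EuclideanSpace ℝ (Fin n)))
    have hbad : ∀ x, (S.card : ℝ) * (1 - subspaceBound n k) ≤ ((S \ bad x).card : ℝ) := by
      intro x
      have h := card_le_subspaceBound_mul hn L hB S hS (by omega : k ≤ n)
        (fun i => (x i : EuclideanSpace ℝ (Fin n))) (bad x) (Finset.filter_subset _ _)
        fun v hv => (Finset.mem_filter.mp hv).2
      have h2 : ((S \ bad x).card : ℝ) = S.card - (bad x).card := by
        rw [Finset.card_sdiff_of_subset (Finset.filter_subset _ _),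
          Nat.cast_sub (Finset.card_le_card (Finset.filter_subset _ _))]
      rw [h2]; linarith
    have hinj : (G.sigma fun x => S \ bad x).card ≤
        ((Fintype.piFinset fun _ : Fin (k + 1) => S).filter fun x =>
          LinearIndependent ℝ fun i => (x i : EuclideanSpace ℝ (Fin n))).card := by
      refine Finset.card_le_card_of_injOn
        (fun p => (Fin.snoc (α := fun _ => L) p.1 p.2 : Fin (k + 1) → L)) ?_ ?_
      · rintro ⟨x, v⟩ hp
        simp only [Finset.coe_sigma, Set.mem_sigma_iff, Finset.mem_coe, hG, Finset.mem_filter,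
          Fintype.mem_piFinset, Finset.mem_sdiff, bad, not_and] at hp ⊢
        obtain ⟨⟨hxS, hx⟩, hvS, hv⟩ := hp
        refine ⟨fun i => ?_, ?_⟩
        · refine Fin.lastCases ?_ (fun j => ?_) i
          · simpa using hvS
          · simpa using hxS j
        · have e : (fun i => ((Fin.snoc (α := fun _ => L) x v : Fin (k + 1) → L) i :
              EuclideanSpace ℝ (Fin n))) =
              Fin.snoc (α := fun _ => EuclideanSpace ℝ (Fin n))
                (fun i => (x i : EuclideanSpace ℝ (Fin n)))
                (v : EuclideanSpace ℝ (Fin n)) := by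
            funext i
            refine Fin.lastCases ?_ (fun j => ?_) i <;> simp
          rw [e]
          exact linearIndependent_finSnoc.mpr ⟨hx, hv hvS⟩
      · rintro ⟨x, v⟩ - ⟨x', v'⟩ - h
        obtain ⟨rfl, rfl⟩ : x = x' ∧ v = v' := Fin.snoc_injective2 h
        rfl
    refine le_trans ?_ (Nat.cast_le.mpr hinj)
    rw [Finset.card_sigma, Nat.cast_sum, Finset.prod_range_succ]
    have hq : 0 ≤ 1 - subspaceBound n k := sub_nonneg.mpr (subspaceBound_le_one (by omega))
    calc (S.card : ℝ) ^ (k + 1) *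
          ((∏ i ∈ Finset.range k, (1 - subspaceBound n i)) * (1 - subspaceBound n k))
        = ((S.card : ℝ) ^ k * ∏ i ∈ Finset.range k, (1 - subspaceBound n i)) *
          (S.card * (1 - subspaceBound n k)) := by ring
      _ ≤ G.card * (S.card * (1 - subspaceBound n k)) :=
          mul_le_mul_of_nonneg_right ih (by positivity)
      _ = ∑ _x ∈ G, (S.card : ℝ) * (1 - subspaceBound n k) := by simp
      _ ≤ _ := Finset.sum_le_sum fun x _ => hbad x

/-! ### Equidistribution modulo the sublattice of the first vectors -/

open Classical in
/-- The half-open parallelepiped spanned by vectors of `[0, B)ⁿ` is a tile of the sublattice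
generated by them, and lies in `[0, nB]ⁿ`; hence the points of the window `[0, B₁)ⁿ` in any coset
of the sublattice number between `(B₁ - nB)ⁿ / V` and `(B₁ + nB)ⁿ / V`, where `V` is the volume
of the parallelepiped. -/
theorem exists_card_coset_bounds {n : ℕ} (hn : 1 ≤ n)
    (L : Submodule ℤ (EuclideanSpace ℝ (Fin n))) {B B₁ : ℝ} (hB : 0 ≤ B) (hB₁ : n * B ≤ B₁)
    (S₁ : Finset L) (hS₁ : ∀ v : L, v ∈ S₁ ↔ (v : EuclideanSpace ℝ (Fin n)) ∈ window n B₁)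
    (x : Fin n → L) (hx : LinearIndependent ℝ fun i => (x i : EuclideanSpace ℝ (Fin n)))
    (hxB : ∀ i, (x i : EuclideanSpace ℝ (Fin n)) ∈ window n B) :
    ∃ V : ℝ, 0 < V ∧ ∀ c : L ⧸ Submodule.span ℤ (Set.range x),
      (B₁ - n * B) ^ n ≤ (S₁.filter fun v => Submodule.Quotient.mk v = c).card * V ∧
      (S₁.filter fun v => Submodule.Quotient.mk v = c).card * V ≤ (B₁ + n * B) ^ n := by
  have : Nonempty (Fin n) := ⟨⟨0, hn⟩⟩
  let b := basisOfLinearIndependentOfCardEqFinrank hx (by simp)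
  have hb : ∀ i, b i = x i := fun i => by simp [b]
  set F := ZSpan.fundamentalDomain b
  have hspan : Submodule.span ℤ (Set.range b) =
      (Submodule.span ℤ (Set.range x)).map L.subtype := by
    rw [Submodule.map_span, ← Set.range_comp]
    congr 2
    funext i; exact hb i
  have hF : IsTile ((Submodule.span ℤ (Set.range x)).map L.subtype) F :=
    hspan ▸ isTile_fundamentalDomain b
  have hbd : Bornology.IsBounded F := ZSpan.fundamentalDomain_isBounded b
  have : Countable ((Submodule.span ℤ (Set.range x)).map L.subtype) := by
    rw [← hspan]; infer_instance
  have hVtop := hbd.measure_lt_top (μ := volume) |>.ne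
  have hnB : 0 ≤ n * B := by positivity
  have hFbox : ∀ f ∈ F, ∀ j, f j ∈ Set.Icc 0 (n * B) := by
    intro f hf j
    have hf' := ZSpan.mem_fundamentalDomain b |>.mp hf
    have e : f j = ∑ i, b.repr f i * (x i : EuclideanSpace ℝ (Fin n)) j := by
      conv_lhs => rw [← b.sum_repr f]
      simp [hb]
    rw [e]
    constructor
    · exact Finset.sum_nonneg fun i _ => mul_nonneg (hf' i).1 (hxB i j).1
    · calc _ ≤ ∑ _i : Fin n, B := Finset.sum_le_sum fun i _ => by
            have h1 := hf' i
            have h2 := hxB i j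
            simp only [Set.mem_Ico] at h1 h2
            nlinarith [mul_nonneg h1.1 h2.1]
        _ = n * B := by simp
  refine ⟨(volume F).toReal, hF.toReal_volume_pos hbd, fun c => ?_⟩
  obtain ⟨u, rfl⟩ := Submodule.Quotient.mk_surjective _ c
  set T := S₁.filter fun v => (Submodule.Quotient.mk v : L ⧸ Submodule.span ℤ (Set.range x)) =
    Submodule.Quotient.mk u
  have hVe : volume F = ENNReal.ofReal (volume F).toReal := (ENNReal.ofReal_toReal hVtop).symm
  have hV0 : 0 ≤ (volume F).toReal := ENNReal.toReal_nonneg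
  constructor
  · have h : volume {x : EuclideanSpace ℝ (Fin n) | ∀ i, x i ∈ Set.Ico (n * B) B₁} ≤
        T.card * volume F := by
      refine volume_le_card_mul T fun y hy => ?_
      obtain ⟨_, ⟨v, hv, rfl⟩, h⟩ := hF.exists_sub_mem (y - u)
      have h' : y - ((u + v : L) : EuclideanSpace ℝ (Fin n)) ∈ F := by
        rw [Submodule.coe_add, ← sub_sub]; exact h
      refine ⟨u + v, Finset.mem_filter.mpr ⟨(hS₁ _).mpr fun j => ?_, ?_⟩, h'⟩
      · have h1 := hFbox _ h' j
        have h2 := hy j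
        rw [PiLp.sub_apply] at h1
        simp only [Set.mem_Ico, Set.mem_Icc] at h1 h2 ⊢
        constructor <;> linarith
      · rw [Submodule.Quotient.eq, add_sub_cancel_left]; exact hv
    rw [volume_cube, hVe, ← ENNReal.ofReal_pow (by linarith), ← ENNReal.ofReal_natCast,
      ← ENNReal.ofReal_mul (Nat.cast_nonneg _)] at h
    exact (ENNReal.ofReal_le_ofReal_iff (mul_nonneg (Nat.cast_nonneg _) hV0)).mp h
  · have h := hF.card_mul_volume_le
      (A := {x : EuclideanSpace ℝ (Fin n) | ∀ i, x i ∈ Set.Ico 0 (B₁ + n * B)}) T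
      (fun s hs t ht => ?_) (fun t ht f hf j => ?_)
    · rw [volume_cube, sub_zero, hVe, ← ENNReal.ofReal_pow (by linarith),
        ← ENNReal.ofReal_natCast, ← ENNReal.ofReal_mul (Nat.cast_nonneg _)] at h
      exact (ENNReal.ofReal_le_ofReal_iff (pow_nonneg (by linarith) _)).mp h
    · refine ⟨s - t, ?_, rfl⟩
      exact (Submodule.Quotient.eq _).mp
        ((Finset.mem_filter.mp hs).2.trans (Finset.mem_filter.mp ht).2.symm)
    · have h1 := hFbox f hf j
      have h2 := (hS₁ t).mp (Finset.mem_filter.mp ht).1 j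
      rw [PiLp.add_apply]
      simp only [Set.mem_Ico, Set.mem_Icc] at h1 h2 ⊢
      constructor <;> linarith

/-- Bernoulli's inequality for `((B₁ - nB) / (B₁ + nB)) ^ (n (n + 1))`. -/
theorem three_quarters_le_ratio_pow {n : ℕ} {B B₁ : ℝ} (hn : 1 ≤ n) (hB : 0 < B)
    (hB₁ : 8 * (n : ℝ) ^ 2 * ((n : ℝ) + 1) * B ≤ B₁) :
    3 / 4 ≤ (((B₁ - n * B) / (B₁ + n * B)) ^ n) ^ (n + 1) := by
  have hn' : (1 : ℝ) ≤ n := by exact_mod_cast hn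
  have hB₁0 : 0 < B₁ := lt_of_lt_of_le (by positivity) hB₁
  have hpos : 0 < B₁ + n * B := by positivity
  have hle : 2 * (n * B) / (B₁ + n * B) ≤ 2 := by
    rw [div_le_iff₀ hpos]; nlinarith
  have h := one_add_mul_le_pow (a := -(2 * (n * B) / (B₁ + n * B))) (by linarith) (n * (n + 1))
  have e : 1 + -(2 * (n * B) / (B₁ + n * B)) = (B₁ - n * B) / (B₁ + n * B) := by
    field_simp; ring
  rw [e] at h
  rw [← pow_mul]
  refine le_trans ?_ h
  push_cast
  have : n * ((n : ℝ) + 1) * (2 * (n * B) / (B₁ + n * B)) ≤ 1 / 4 := by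
    rw [mul_div_assoc', div_le_iff₀ hpos]
    have : 0 ≤ n * B := by positivity
    nlinarith
  linarith

open Classical in
/-- If the vectors `x` are linearly independent, then the classes of the `y` are nearly uniform in
the finite group `L / ⟨x⟩`, which is generated by `n` elements. -/
theorem card_generating_ge {n : ℕ} (hn : 1 ≤ n)
    (L : Submodule ℤ (EuclideanSpace ℝ (Fin n))) [DiscreteTopology L] [IsZLattice ℝ L]
    {B B₁ : ℝ} (hB : 0 < B) (hB₁ : 8 * (n : ℝ) ^ 2 * ((n : ℝ) + 1) * B ≤ B₁)
    (S₁ : Finset L) (hS₁ : ∀ v : L, v ∈ S₁ ↔ (v : EuclideanSpace ℝ (Fin n)) ∈ window n B₁)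
    (x : Fin n → L) (hx : LinearIndependent ℝ fun i => (x i : EuclideanSpace ℝ (Fin n)))
    (hxB : ∀ i, (x i : EuclideanSpace ℝ (Fin n)) ∈ window n B) :
    (invZetaProd n - 1 / 4) * (S₁.card : ℝ) ^ (n + 1) ≤
      ((Fintype.piFinset fun _ : Fin (n + 1) => S₁).filter fun y =>
        Submodule.span ℤ (Set.range x ∪ Set.range y) = ⊤).card := by
  have hn' : (1 : ℝ) ≤ n := by exact_mod_cast hn
  have hnB₁ : n * B < B₁ := by
    refine lt_of_lt_of_le ?_ hB₁
    have h1 : (n : ℝ) * 1 ≤ n * (8 * n * (n + 1) - 1) :=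
      mul_le_mul_of_nonneg_left (by nlinarith) (by linarith)
    nlinarith
  have hnB : 0 < n * B := by positivity
  obtain ⟨V, hV, hN⟩ := exists_card_coset_bounds hn L hB.le hnB₁.le S₁ hS₁ x hx hxB
  set M := Submodule.span ℤ (Set.range x)
  let N : L ⧸ M → ℕ := fun c => (S₁.filter fun v => (Submodule.Quotient.mk v : L ⧸ M) = c).card
  -- every coset meets the window, so that there are finitely many of them
  have hsurj : ∀ c : L ⧸ M, ∃ v ∈ S₁, (Submodule.Quotient.mk v : L ⧸ M) = c := by
    intro c
    have h := (hN c).1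
    have h0 : 0 < (B₁ - n * B) ^ n := pow_pos (by linarith) n
    by_contra hne
    push Not at hne
    rw [Finset.filter_false_of_mem hne] at h
    simp at h
    linarith
  have hfin : Finite (L ⧸ M) :=
    Finite.of_surjective (fun v : S₁ => (Submodule.Quotient.mk (v : L) : L ⧸ M)) fun c => by
      obtain ⟨v, hv, h⟩ := hsurj c
      exact ⟨⟨v, hv⟩, h⟩
  have := Fintype.ofFinite (L ⧸ M)
  set m := Nat.card (L ⧸ M)
  have hm0 : (0 : ℝ) < m := by exact_mod_cast Nat.card_pos
  set ρ := ((B₁ - n * B) / (B₁ + n * B)) ^ n with hρ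
  have hpos : 0 < B₁ + n * B := by linarith
  have hρ0 : 0 ≤ ρ := pow_nonneg (div_nonneg (by linarith) hpos.le) n
  have htotal : (S₁.card : ℝ) * V ≤ m * (B₁ + n * B) ^ n := by
    have h1 : S₁.card = ∑ c : L ⧸ M, N c :=
      Finset.card_eq_sum_card_fiberwise fun v _ => Finset.mem_univ _
    rw [h1, Nat.cast_sum, Finset.sum_mul]
    refine (Finset.sum_le_sum fun c _ => (hN c).2).trans_eq ?_
    rw [Finset.sum_const, Finset.card_univ, ← Nat.card_eq_fintype_card, nsmul_eq_mul]
  have hNc : ∀ c, ρ * S₁.card / m ≤ N c := by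
    intro c
    rw [div_le_iff₀ hm0]
    refine le_of_mul_le_mul_right ?_ hV
    calc ρ * S₁.card * V = ρ * (S₁.card * V) := by ring
      _ ≤ ρ * (m * (B₁ + n * B) ^ n) := mul_le_mul_of_nonneg_left htotal hρ0
      _ = m * (B₁ - n * B) ^ n := by rw [hρ, div_pow]; field_simp
      _ ≤ m * (N c * V) := mul_le_mul_of_nonneg_left (hN c).1 hm0.le
      _ = N c * m * V := by ring
  -- the quotient is generated by the classes of a basis of the lattice
  have : Module.Free ℤ L := ZLattice.module_free ℝ L
  have : Module.Finite ℤ L := ZLattice.module_finite ℝ L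
  have hrank : Module.finrank ℤ L = n := by rw [ZLattice.rank ℝ L, finrank_euclideanSpace_fin]
  let bL := (Module.finBasisOfFinrankEq ℤ L hrank)
  have hgen : Submodule.span ℤ (Set.range fun i => M.mkQ (bL i)) = ⊤ := by
    have h := congrArg (Submodule.map M.mkQ) bL.span_eq
    rwa [Submodule.map_span, ← Set.range_comp, Submodule.map_top, Submodule.range_mkQ] at h
  have hgroup := invZetaProd_mul_card_pow_le (fun i => M.mkQ (bL i)) hgen
  set Γ := {g : Fin (n + 1) → L ⧸ M | Submodule.span ℤ (Set.range g) = ⊤}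
  let Y : (Fin (n + 1) → L ⧸ M) → Finset (Fin (n + 1) → L) := fun g =>
    Fintype.piFinset fun j => S₁.filter fun v => (Submodule.Quotient.mk v : L ⧸ M) = g j
  have hdisj : (Γ.toFinset : Set (Fin (n + 1) → L ⧸ M)).PairwiseDisjoint Y := by
    intro g _ g' _ hne
    rw [Function.onFun, Finset.disjoint_left]
    intro y hy hy'
    refine hne (funext fun j => ?_)
    have h1 := (Finset.mem_filter.mp (Fintype.mem_piFinset.mp hy j)).2
    have h2 := (Finset.mem_filter.mp (Fintype.mem_piFinset.mp hy' j)).2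
    exact h1.symm.trans h2
  have hsub : Γ.toFinset.biUnion Y ⊆
      (Fintype.piFinset fun _ : Fin (n + 1) => S₁).filter fun y =>
        Submodule.span ℤ (Set.range x ∪ Set.range y) = ⊤ := by
    intro y hy
    obtain ⟨g, hg, hy⟩ := Finset.mem_biUnion.mp hy
    have hg' : Submodule.span ℤ (Set.range g) = ⊤ := (Set.mem_toFinset.mp hg : g ∈ Γ)
    have hyj := fun j => Finset.mem_filter.mp (Fintype.mem_piFinset.mp hy j)
    refine Finset.mem_filter.mpr ⟨Fintype.mem_piFinset.mpr fun j => (hyj j).1, ?_⟩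
    have hgy : g = M.mkQ ∘ y := funext fun j => (hyj j).2.symm
    rw [hgy, Set.range_comp, ← Submodule.map_span] at hg'
    have h := congrArg (Submodule.comap M.mkQ) hg'
    rwa [Submodule.comap_map_mkQ, Submodule.comap_top, ← Submodule.span_union] at h
  have hcard : (Γ.ncard : ℝ) * (ρ * S₁.card / m) ^ (n + 1) ≤ (Γ.toFinset.biUnion Y).card := by
    rw [Finset.card_biUnion hdisj, Set.ncard_eq_toFinset_card', Nat.cast_sum, ← nsmul_eq_mul,
      ← Finset.sum_const]
    refine Finset.sum_le_sum fun g _ => ?_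
    rw [Fintype.card_piFinset, Nat.cast_prod]
    calc (ρ * S₁.card / m) ^ (n + 1) = ∏ _j : Fin (n + 1), (ρ * S₁.card / m) := by
          rw [Finset.prod_const, Finset.card_univ, Fintype.card_fin]
      _ ≤ _ := Finset.prod_le_prod (fun _ _ => by positivity) fun j _ => hNc (g j)
  refine le_trans ?_ (hcard.trans (Nat.cast_le.mpr (Finset.card_le_card hsub)))
  have h34 : 3 / 4 ≤ ρ ^ (n + 1) := three_quarters_le_ratio_pow hn hB hB₁
  have hz1 := invZetaProd_le_one n
  have hz0 := invZetaProd_nonneg n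
  calc (invZetaProd n - 1 / 4) * (S₁.card : ℝ) ^ (n + 1)
      ≤ (invZetaProd n * ρ ^ (n + 1)) * (S₁.card : ℝ) ^ (n + 1) := by
        refine mul_le_mul_of_nonneg_right ?_ (by positivity)
        nlinarith
    _ = invZetaProd n * (m : ℝ) ^ (n + 1) * (ρ * S₁.card / m) ^ (n + 1) := by
        rw [div_pow, mul_pow]; field_simp
    _ ≤ _ := mul_le_mul_of_nonneg_right hgroup (by positivity)

/-! ### From counting to probability -/

theorem uniformOn_singleton_of_mem {α : Type*} [MeasurableSpace α] [MeasurableSingletonClass α]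
    {s : Set α} (hs : s.Finite) {a : α} (ha : a ∈ s) :
    uniformOn s {a} = (s.ncard : ENNReal)⁻¹ := by
  rw [uniformOn, cond_apply hs.measurableSet,
    Set.inter_eq_right.mpr (Set.singleton_subset_iff.mpr ha),
    Measure.count_singleton, mul_one, Measure.count_apply_finite _ hs,
    Set.ncard_eq_toFinset_card _ hs]

/-- For independent variables, each uniform on a finite set, an event that contains all tuples of
the finite set `T` has at least the probability that counting gives. -/
theorem card_div_prod_le_measureReal {Ω ι α : Type*} [Fintype ι] [MeasurableSpace Ω]
    [MeasurableSpace α] [MeasurableSingletonClass α] (P : Measure Ω) [IsProbabilityMeasure P]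
    (Z : ι → Ω → α) (s : ι → Set α) (hs : ∀ i, (s i).Finite)
    (hZ : ∀ i, HasLaw (Z i) (uniformOn (s i)) P) (hindep : iIndepFun Z P)
    (T : Finset (ι → α)) (hT : ∀ t ∈ T, ∀ i, t i ∈ s i) (E : Set Ω)
    (hE : ∀ ω, (fun i => Z i ω) ∈ T → ω ∈ E) :
    (T.card : ℝ) / ∏ i, ((s i).ncard : ℝ) ≤ P.real E := by
  have hpt : ∀ t ∈ T, P (⋂ i, Z i ⁻¹' {t i}) = ∏ i, ((s i).ncard : ENNReal)⁻¹ := by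
    intro t ht
    have h := hindep.measure_inter_preimage_eq_mul Finset.univ (sets := fun i => {t i})
      fun i _ => measurableSet_singleton _
    simp only [Finset.mem_univ, Set.iInter_true] at h
    rw [h]
    refine Finset.prod_congr rfl fun i _ => ?_
    rw [← Measure.map_apply_of_aemeasurable (hZ i).aemeasurable (measurableSet_singleton _),
      (hZ i).map_eq, uniformOn_singleton_of_mem (hs i) (hT t ht i)]
  have hnull : ∀ t ∈ T, NullMeasurableSet (⋂ i, Z i ⁻¹' {t i}) P := fun t _ =>
    NullMeasurableSet.iInter fun i =>
      (hZ i).aemeasurable.nullMeasurable (measurableSet_singleton _)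
  have hdisj : (T : Set (ι → α)).PairwiseDisjoint fun t => ⋂ i, Z i ⁻¹' {t i} := by
    intro t _ t' _ hne
    rw [Function.onFun, Set.disjoint_left]
    intro ω h h'
    refine hne (funext fun i => ?_)
    have h1 : Z i ω = t i := Set.mem_iInter.mp h i
    have h2 : Z i ω = t' i := Set.mem_iInter.mp h' i
    exact h1.symm.trans h2
  have hle : (T.card : ENNReal) * ∏ i, ((s i).ncard : ENNReal)⁻¹ ≤ P E := by
    calc (T.card : ENNReal) * ∏ i, ((s i).ncard : ENNReal)⁻¹
        = ∑ t ∈ T, P (⋂ i, Z i ⁻¹' {t i}) := by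
          rw [Finset.sum_congr rfl hpt, Finset.sum_const, nsmul_eq_mul]
      _ = P (⋃ t ∈ T, ⋂ i, Z i ⁻¹' {t i}) :=
          (measure_biUnion_finset₀ (fun t ht t' ht' hne => (hdisj ht ht' hne).aedisjoint) hnull).symm
      _ ≤ P E := measure_mono (Set.iUnion₂_subset fun t ht ω hω => hE ω (by
          have e : (fun i => Z i ω) = t := funext fun i => Set.mem_iInter.mp hω i
          rwa [e]))
  have h := ENNReal.toReal_mono (measure_ne_top P E) hle
  rw [ENNReal.toReal_mul, ENNReal.toReal_prod, ENNReal.toReal_natCast] at h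
  simp only [ENNReal.toReal_inv, ENNReal.toReal_natCast, Finset.prod_inv_distrib] at h
  rw [div_eq_mul_inv]
  exact h

theorem theorem1 (n : ℕ) (hn : 1 ≤ n)
    (L : Submodule ℤ (EuclideanSpace ℝ (Fin n))) [DiscreteTopology L] [IsZLattice ℝ L]
    (B B₁ : ℝ)
    (hB : 8 * (n : ℝ) ^ ((n : ℝ) / 2) * coveringRadius L ≤ B)
    (hB₁ : 8 * (n : ℝ) ^ 2 * ((n : ℝ) + 1) * B ≤ B₁)
    {Ω : Type*} [MeasurableSpace Ω] (P : Measure Ω) [IsProbabilityMeasure P]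
    (X : Fin n → Ω → EuclideanSpace ℝ (Fin n))
    (Y : Fin (n + 1) → Ω → EuclideanSpace ℝ (Fin n))
    (hX : ∀ i, HasLaw (X i) (uniformOn ((L : Set (EuclideanSpace ℝ (Fin n))) ∩ window n B)) P)
    (hY : ∀ j, HasLaw (Y j) (uniformOn ((L : Set (EuclideanSpace ℝ (Fin n))) ∩ window n B₁)) P)
    (hindep : iIndepFun (Sum.elim X Y) P) :
    alpha n ≤ P.real {ω | Submodule.span ℤ
        (Set.range (fun i => X i ω) ∪ Set.range (fun j => Y j ω)) = L} ∧
      0.092 ≤ alpha n := by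
  classical
  refine ⟨?_, le_alpha hn⟩
  have hn' : (1 : ℝ) ≤ n := by exact_mod_cast hn
  have hBpos : 0 < B := lt_of_lt_of_le
    (mul_pos (mul_pos (by norm_num) (Real.rpow_pos_of_pos (by linarith) _))
      (coveringRadius_pos L hn)) hB
  have hB₁pos : 0 < B₁ := lt_of_lt_of_le (by positivity) hB₁
  have hwin : ∀ C : ℝ, ∃ S : Finset L,
      (∀ v : L, v ∈ S ↔ (v : EuclideanSpace ℝ (Fin n)) ∈ window n C) ∧
      (L : Set (EuclideanSpace ℝ (Fin n))) ∩ window n C = Subtype.val '' (S : Set L) ∧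
      (0 < C → 0 < S.card) := fun C => by
    refine ⟨(finite_window L C).toFinset, fun v => by simp, ?_, fun hC => ?_⟩
    · ext v
      simp only [Set.mem_inter_iff, Set.Finite.coe_toFinset, Set.mem_image]
      exact ⟨fun h => ⟨⟨v, h.1⟩, h.2, rfl⟩, by rintro ⟨w, hw, rfl⟩; exact ⟨w.2, hw⟩⟩
    · refine Finset.card_pos.mpr ⟨0, ?_⟩
      simp [window, hC]
  obtain ⟨S, hS, hSimg, hS0⟩ := hwin B
  obtain ⟨S₁, hS₁, hS₁img, hS₁0⟩ := hwin B₁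
  have hncard : ∀ S : Finset L,
      (Subtype.val '' (S : Set L) : Set (EuclideanSpace ℝ (Fin n))).ncard = S.card := fun S => by
    rw [Set.ncard_image_of_injective _ Subtype.val_injective, Set.ncard_coe_finset]
  -- the good tuples: `x` linearly independent, and `x`, `y` generating
  set G := (Fintype.piFinset fun _ : Fin n => S).filter fun x =>
    LinearIndependent ℝ fun i => (x i : EuclideanSpace ℝ (Fin n))
  let H : (Fin n → L) → Finset (Fin (n + 1) → L) := fun x =>
    (Fintype.piFinset fun _ : Fin (n + 1) => S₁).filter fun y =>
      Submodule.span ℤ (Set.range x ∪ Set.range y) = ⊤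
  let T : Finset (Fin n ⊕ Fin (n + 1) → EuclideanSpace ℝ (Fin n)) :=
    (G.sigma H).image fun p => Sum.elim (fun i => (p.1 i : EuclideanSpace ℝ (Fin n)))
      fun j => (p.2 j : EuclideanSpace ℝ (Fin n))
  have hTcard : T.card = ∑ x ∈ G, (H x).card := by
    rw [Finset.card_image_of_injective, Finset.card_sigma]
    rintro ⟨x, y⟩ ⟨x', y'⟩ h
    obtain rfl : x = x' := funext fun i => Subtype.ext (congrFun h (Sum.inl i))
    obtain rfl : y = y' := funext fun j => Subtype.ext (congrFun h (Sum.inr j))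
    rfl
  have hprob := card_div_prod_le_measureReal P (Sum.elim X Y)
    (Sum.elim (fun _ => (L : Set (EuclideanSpace ℝ (Fin n))) ∩ window n B)
      fun _ => (L : Set (EuclideanSpace ℝ (Fin n))) ∩ window n B₁)
    (by rintro (i | j)
        · simp only [Sum.elim_inl, hSimg]; exact S.finite_toSet.image _
        · simp only [Sum.elim_inr, hS₁img]; exact S₁.finite_toSet.image _)
    (by rintro (i | j); exacts [hX i, hY j]) hindep T
    (by
      intro t ht
      obtain ⟨⟨x, y⟩, hp, rfl⟩ := Finset.mem_image.mp ht
      obtain ⟨hx, hy⟩ := Finset.mem_sigma.mp hp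
      have hx' := Fintype.mem_piFinset.mp (Finset.mem_filter.mp hx).1
      have hy' := Fintype.mem_piFinset.mp (Finset.mem_filter.mp hy).1
      rintro (i | j)
      · exact ⟨(x i).2, (hS _).mp (hx' i)⟩
      · exact ⟨(y j).2, (hS₁ _).mp (hy' j)⟩)
    {ω | Submodule.span ℤ (Set.range (fun i => X i ω) ∪ Set.range (fun j => Y j ω)) = L}
    (by
      intro ω hω
      obtain ⟨⟨x, y⟩, hp, h⟩ := Finset.mem_image.mp hω
      obtain ⟨-, hy⟩ := Finset.mem_sigma.mp hp
      have hspan := congrArg (Submodule.map L.subtype) (Finset.mem_filter.mp hy).2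
      have h1 : (fun i => X i ω) = L.subtype ∘ x := funext fun i => (congrFun h (Sum.inl i)).symm
      have h2 : (fun j => Y j ω) = L.subtype ∘ y := funext fun j => (congrFun h (Sum.inr j)).symm
      rw [Submodule.map_span, Set.image_union, ← Set.range_comp, ← Set.range_comp, ← h1, ← h2,
        Submodule.map_top, Submodule.range_subtype] at hspan
      exact hspan)
  refine le_trans ?_ hprob
  rw [Fintype.prod_sum_type]
  simp only [Sum.elim_inl, Sum.elim_inr, hSimg, hS₁img, hncard, Finset.prod_const,
    Finset.card_univ, Fintype.card_fin]
  have hSpos : (0 : ℝ) < S.card := by exact_mod_cast hS0 hBpos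
  have hS₁pos : (0 : ℝ) < S₁.card := by exact_mod_cast hS₁0 hB₁pos
  rw [le_div_iff₀ (by positivity), hTcard, Nat.cast_sum]
  have hG := card_linearIndependent_ge hn L hB S hS le_rfl
  have hH : ∀ x ∈ G, (invZetaProd n - 1 / 4) * (S₁.card : ℝ) ^ (n + 1) ≤ (H x).card :=
    fun x hx => card_generating_ge hn L hBpos hB₁ S₁ hS₁ x (Finset.mem_filter.mp hx).2
      fun i => (hS _).mp (Fintype.mem_piFinset.mp (Finset.mem_filter.mp hx).1 i)
  have hz : 0 ≤ invZetaProd n - 1 / 4 := by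
    have h1 := one_sub_six_div_pi_sq_le_invZetaProd hn
    have h3 : 6 / Real.pi ^ 2 ≤ 2 / 3 := by
      rw [div_le_iff₀ (by positivity)]
      nlinarith [Real.pi_gt_three]
    linarith
  calc alpha n * ((S.card : ℝ) ^ n * (S₁.card : ℝ) ^ (n + 1))
      = ((S.card : ℝ) ^ n * ∏ k ∈ Finset.range n, (1 - subspaceBound n k)) *
        ((invZetaProd n - 1 / 4) * (S₁.card : ℝ) ^ (n + 1)) := by rw [alpha_eq]; ring
    _ ≤ G.card * ((invZetaProd n - 1 / 4) * (S₁.card : ℝ) ^ (n + 1)) :=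
        mul_le_mul_of_nonneg_right hG (by positivity)
    _ = ∑ _x ∈ G, (invZetaProd n - 1 / 4) * (S₁.card : ℝ) ^ (n + 1) := by
        rw [Finset.sum_const, nsmul_eq_mul]
    _ ≤ _ := Finset.sum_le_sum hH
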